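/- Let $\mathcal P$ be a finite poset. For $p\in\mathcal P$ and an order ideal $I\in\mathcal J(\mathcal P)$ put $\mathbb 1_p(I)=1$ if $p\in I$ and $0$ otherwise; $\mathcal T_p^-(I)=1$ if $p$ is a maximal element of $I$ and $0$ otherwise; $\mathcal T_p^+(I)=1$ if $p\notin I$ and $I\cup\{p\}\in\mathcal J(\mathcal P)$, and $0$ otherwise; and $\mathcal T_p=\mathcal T_p^+-\mathcal T_p^-$. Rowmotion sends $I$ to the order ideal generated by the minimal elements of $\mathcal P\setminus I$; a function $\mathcal J(\mathcal P)\to\mathbb R$ is homomesic if it has the same average on every rowmotion orbit. Let $I_T(\mathcal P)$ (resp. $A_T(\mathcal P)$) be the real vector space of homomesic functions in $\mathrm{Span}_{\mathbb R}(\mathbb 1_p : p\in\mathcal P)$ (resp. $\mathrm{Span}_{\mathbb R}(\mathcal T_p^- : p\in\mathcal P)$) that are linear combinations of a constant function and the functions $\mathcal T_p$, $p\in\mathcal P$. Let $\mathrm{rk}(\mathcal P)$ be one less than the maximal cardinality of a chain of $\mathcal P$; the width of a finite poset is the maximal cardinality of an antichain. A diagram is a finite set $D\subset\mathbb N\times\mathbb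 N$ of cells in matrix coordinates, ordered by $(i,j)\preceq(i',j')$ iff $i\le i'$ and $j\le j'$; $\mathcal P$ is defined by $D$ if it is isomorphic to $D$ with this order. $D$ is simply connected if any two of its cells are joined by a path of pairwise edge-adjacent cells of $D$ and no position outside $D$ has all of its four edge neighbours in $D$. A unit edge is on the boundary of $D$ if exactly one of the two positions that it separates is in $D$. An outward corner of $D$ associated to a cell $x\in D$ is a lattice point strictly northwest of (the centre of) $x$ whose west and north unit edges are both on the boundary of $D$, or a lattice point strictly southeast of $x$ whose east and south unit edges are both on the boundary of $D$. $D$ has no outward corners if no cell of $D$ has one. Theorem. If $\mathcal P$ is defined by a simply connected diagram with no outward corners, then $$\dim A_T(\mathcal P)=\dim I_T(\mathcal P)=\mathrm{rk}(\mathcal P)+1 .$$ The same holds if $\mathcal P$ is isomorphic to the distributive lattice $\mathcal J(Q)$ of order ideals of a finite poset $Q$ of width at most two. Moreover, a nonempty finite poset $\mathcal P$ is defined by a simply connected diagram with no outward corners if and only if it is isomorphic to $\mathcal J(Q)$ for some finite poset $Q$ of width at most two. -/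

import Mathlib

universe u v

noncomputable section

/-! ### Diagrams

A diagram is a finite set of cells in `ℕ × ℕ`, in matrix coordinates: `(i, j)` is the cell in row `i`
(numbered downwards) and column `j` (numbered to the right). The product order on `ℕ × ℕ` is the
order "weakly southeast". -/

namespace Diagram

/-- Two cells share an edge. -/
def EdgeAdj (x y : ℕ × ℕ) : Prop :=
  (x.1 = y.1 ∧ (x.2 + 1 = y.2 ∨ y.2 + 1 = x.2)) ∨ (x.2 = y.2 ∧ (x.1 + 1 = y.1 ∨ y.1 + 1 = x.1))

/-- Any two cells of `D` are joined by a path of cells of `D` with consecutive ones edge adjacent. -/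
def IsConnected (D : Finset (ℕ × ℕ)) : Prop :=
  ∀ x ∈ D, ∀ y ∈ D, Relation.ReflTransGen (fun a b => a ∈ D ∧ b ∈ D ∧ EdgeAdj a b) x y

/-- No position outside `D` has its four edge neighbours in `D`; the position is written
`(i + 1, j + 1)`, since a position in row or column `0` does not have four neighbours. -/
def NoHoles (D : Finset (ℕ × ℕ)) : Prop :=
  ¬ ∃ i j : ℕ, (i, j + 1) ∈ D ∧ (i + 2, j + 1) ∈ D ∧ (i + 1, j) ∈ D ∧ (i + 1, j + 2) ∈ D ∧
    (i + 1, j + 1) ∉ D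

/-- Simply connected: connected and without holes. -/
def IsSimplyConnected (D : Finset (ℕ × ℕ)) : Prop :=
  IsConnected D ∧ NoHoles D

/-- The unit edge between the positions `x` and `y` (which are edge adjacent in every use below) lies
on the boundary of `D`: exactly one of the two is a cell of `D`. -/
def IsBoundaryEdge (D : Finset (ℕ × ℕ)) (x y : ℕ × ℕ) : Prop :=
  Xor (x ∈ D) (y ∈ D)

/-- The lattice point at the bottom right of position `(r, c)` is a corner of the boundary of `D` of
the form `EN` (an east step into the point, then a north step out of it): the unit edges that leave
the point to the west and to the north lie on the boundary. -/
def IsENCorner (D : Finset (ℕ × ℕ)) (r c : ℕ) : Prop :=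
  IsBoundaryEdge D (r, c) (r + 1, c) ∧ IsBoundaryEdge D (r, c) (r, c + 1)

/-- The lattice point at the bottom right of position `(r, c)` is a corner of the boundary of `D` of
the form `NE` (a north step into the point, then an east step out of it): the unit edges that leave
the point to the south and to the east lie on the boundary. -/
def IsNECorner (D : Finset (ℕ × ℕ)) (r c : ℕ) : Prop :=
  IsBoundaryEdge D (r + 1, c) (r + 1, c + 1) ∧ IsBoundaryEdge D (r, c + 1) (r + 1, c + 1)

/-- The lattice point at the bottom right of position `(r, c)` is an outward corner of `D` associated
to the cell `x`: an `EN` corner strictly northwest of `x` or an `NE` corner strictly southeast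
of `x`. -/
def IsOutwardCorner (D : Finset (ℕ × ℕ)) (x : ℕ × ℕ) (r c : ℕ) : Prop :=
  (IsENCorner D r c ∧ r < x.1 ∧ c < x.2) ∨ (IsNECorner D r c ∧ x.1 ≤ r ∧ x.2 ≤ c)

/-- No cell of `D` has an outward corner. (A corner that is strictly northwest or southeast of a cell
is never on the top or left border of the quadrant `ℕ × ℕ`, so it is of the form `(r, c)`.) -/
def NoOutwardCorners (D : Finset (ℕ × ℕ)) : Prop :=
  ∀ x ∈ D, ∀ r c : ℕ, ¬ IsOutwardCorner D x r c

/-- The poset `P` is defined by the diagram `D`: it is isomorphic to the set of cells of `D`, ordered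
by "weakly southeast". -/
def Defines (D : Finset (ℕ × ℕ)) (P : Type u) [PartialOrder P] : Prop :=
  Nonempty (P ≃o {x : ℕ × ℕ // x ∈ D})

end Diagram

/-! ### Rank and width -/

/-- The rank of a finite poset: one less than the maximal cardinality of a chain. -/
def posetRank (P : Type u) [PartialOrder P] : ℤ :=
  ((sSup {n : ℕ | ∃ C : Finset P, IsChain (· ≤ ·) (C : Set P) ∧ C.card = n} : ℕ) : ℤ) - 1

/-- The width of a finite poset: the maximal cardinality of an antichain. -/
def posetWidth (P : Type u) [PartialOrder P] : ℕ :=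
  sSup {n : ℕ | ∃ A : Finset P, IsAntichain (· ≤ ·) (A : Set P) ∧ A.card = n}

/-! ### Statistics on order ideals

The lattice of order ideals of `P` is `LowerSet P`, ordered by inclusion. -/

section Toggle

variable {P : Type u} [PartialOrder P]

open Classical in
/-- The order ideal indicator function of `p`. -/
def idealIndicator (p : P) : LowerSet P → ℝ :=
  fun I => if p ∈ I then 1 else 0

open Classical in
/-- The antichain indicator function of `p`: is `p` a maximal element of the order ideal? -/
def toggleOut (p : P) : LowerSet P → ℝ :=
  fun I => if Maximal (fun q => q ∈ I) p then 1 else 0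

open Classical in
/-- Can `p` be added to the order ideal? -/
def toggleIn (p : P) : LowerSet P → ℝ :=
  fun I => if p ∉ I ∧ IsLowerSet (insert p (I : Set P)) then 1 else 0

/-- The toggleability statistic of `p`. -/
def toggleability (p : P) : LowerSet P → ℝ :=
  toggleIn p - toggleOut p

/-- Rowmotion: the order ideal generated by the minimal elements of the complement. -/
def rowmotion (I : LowerSet P) : LowerSet P :=
  lowerClosure {p : P | Minimal (fun q => q ∉ I) p}

/-- `f` has average `d` on every rowmotion orbit (the orbit of `I` consists of the first
`Function.minimalPeriod rowmotion I` iterates of `I`; both sides are multiplied by the size of the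
orbit). -/
def IsMesic (d : ℝ) (f : LowerSet P → ℝ) : Prop :=
  ∀ I : LowerSet P,
    ∑ k ∈ Finset.range (Function.minimalPeriod rowmotion I), f (rowmotion^[k] I) =
      d * (Function.minimalPeriod (rowmotion (P := P)) I : ℝ)

end Toggle

section Spaces

variable (P : Type u) [PartialOrder P]

/-- The space of statistics that are homomesic under rowmotion. -/
def homomesicSpace : Submodule ℝ (LowerSet P → ℝ) where
  carrier := {f | ∃ d : ℝ, IsMesic d f}
  zero_mem' := ⟨0, fun I => by simp⟩
  add_mem' := by
    rintro f g ⟨d, hf⟩ ⟨e, hg⟩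
    refine ⟨d + e, fun I => ?_⟩
    simp only [Pi.add_apply, Finset.sum_add_distrib]
    rw [hf I, hg I, add_mul]
  smul_mem' := by
    rintro a f ⟨d, hf⟩
    refine ⟨a * d, fun I => ?_⟩
    simp only [Pi.smul_apply, smul_eq_mul]
    rw [← Finset.mul_sum, hf I, mul_assoc]

/-- The linear combinations of the toggleability statistics and a constant. -/
def toggleSpan : Submodule ℝ (LowerSet P → ℝ) :=
  Submodule.span ℝ (insert (fun _ => (1 : ℝ)) (Set.range (toggleability (P := P))))

/-- The homomesic statistics in the span of the order ideal indicator functions. -/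
def homomesicIdealSpace : Submodule ℝ (LowerSet P → ℝ) :=
  Submodule.span ℝ (Set.range (idealIndicator (P := P))) ⊓ homomesicSpace P

/-- The homomesic statistics in the span of the antichain indicator functions. -/
def homomesicAntichainSpace : Submodule ℝ (LowerSet P → ℝ) :=
  Submodule.span ℝ (Set.range (toggleOut (P := P))) ⊓ homomesicSpace P

/-- The order ideal toggleability space `I_T(P)`. -/
def idealToggleSpace : Submodule ℝ (LowerSet P → ℝ) :=
  homomesicIdealSpace P ⊓ toggleSpan P

/-- The antichain toggleability space `A_T(P)`. -/
def antichainToggleSpace : Submodule ℝ (LowerSet P → ℝ) :=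
  homomesicAntichainSpace P ⊓ toggleSpan P

end Spaces

end

noncomputable section

/-! ### Toggleability statistics of a finite poset -/

section ToggleGeneral

variable {P : Type u} [PartialOrder P]

/-! Toggling `p` in at `I` is toggling `p` out at the rowmotion image of `I`, so toggleability
statistics telescope along orbits. Everything in `toggleSpan` is thus homomesic, and both dimensions
become linear algebra on order ideals. Constants and toggleabilities are independent
(`eq_zero_of_sum_toggleability`), and statistics in either span vanish at the empty ideal, so each
space is the image of a subspace of coefficient vectors `c : P → ℝ` under the injective map
`toggleCombination`.

Let `P` be a finite distributive lattice with at most two covers above and below each element. All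
toggle statistics lie in the span of constants, indicators, and products of the indicators of the
two elements covered by a common `x`. The second difference at the square with top `x` reads off the
coefficient of that product; on `toggleCombination c` it equals `c x - c (squareBottom x)`.
Membership in either span becomes one equation for each `x` with two lower covers, expressing `c x`
through earlier or free coordinates. By `finrank_triangular` both dimensions count the remaining
elements: `⊥` and the sup-irreducibles. By Birkhoff's theorem the number of sup-irreducibles is the
rank.

A connected diagram without outward corners is a sublattice of `ℕ × ℕ`: corners are the obstruction
to completing squares, and local completion propagates along paths (`reflTransGen_inf_sup`). A
planar sublattice has at most two covers on each side and sup-irreducibles of width at most two.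
Conversely, a poset of width at most two splits into two chains, and counting an ideal's elements in
each chain embeds its ideals as such a diagram. -/

lemma notMem_and_isLowerSet_insert_iff (p : P) (I : LowerSet P) :
    (p ∉ I ∧ IsLowerSet (insert p (I : Set P))) ↔ Minimal (fun q => q ∉ I) p := by
  constructor
  · rintro ⟨hp, hI⟩
    refine ⟨hp, fun q hq hqp => ?_⟩
    rcases hI hqp (Set.mem_insert p _) with h | h
    · exact h.ge
    · exact absurd h hq
  · intro h
    refine ⟨h.1, fun a b hba ha => ?_⟩
    rcases ha with rfl | ha
    · by_cases hb : b ∈ I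
      · exact Or.inr hb
      · exact Or.inl (le_antisymm hba (h.2 hb hba))
    · exact Or.inr (I.lower hba ha)

open Classical in
lemma toggleIn_apply (p : P) (I : LowerSet P) :
    toggleIn p I = if Minimal (fun q => q ∉ I) p then 1 else 0 := by
  unfold toggleIn
  simp only [notMem_and_isLowerSet_insert_iff]

open Classical in
lemma toggleOut_apply (p : P) (I : LowerSet P) :
    toggleOut p I = if Maximal (fun q => q ∈ I) p then 1 else 0 :=
  rfl

/-- The minimal elements of the complement form an antichain, so they are exactly the maximal
elements of the ideal they generate. -/
lemma maximal_mem_rowmotion_iff (p : P) (I : LowerSet P) :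
    Maximal (fun q => q ∈ rowmotion I) p ↔ Minimal (fun q => q ∉ I) p := by
  constructor
  · rintro ⟨hp, hmax⟩
    obtain ⟨a, ha, hpa⟩ := mem_lowerClosure.1 hp
    have : a ≤ p := hmax (mem_lowerClosure.2 ⟨a, ha, le_rfl⟩) hpa
    rwa [le_antisymm hpa this]
  · intro h
    refine ⟨mem_lowerClosure.2 ⟨p, h, le_rfl⟩, fun q hq hpq => ?_⟩
    obtain ⟨a, ha, hqa⟩ := mem_lowerClosure.1 hq
    exact hqa.trans (ha.2 h.1 (hpq.trans hqa))

lemma toggleOut_rowmotion (p : P) (I : LowerSet P) :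
    toggleOut p (rowmotion I) = toggleIn p I := by
  rw [toggleIn_apply, toggleOut_apply]
  by_cases h : Minimal (fun q => q ∉ I) p
  · rw [if_pos h, if_pos ((maximal_mem_rowmotion_iff p I).2 h)]
  · rw [if_neg h, if_neg (mt (maximal_mem_rowmotion_iff p I).1 h)]

/-- The orbit sum telescopes, since toggling in is toggling out one iterate later. -/
lemma isMesic_toggleability (p : P) : IsMesic 0 (toggleability p) := by
  intro I
  have h : ∀ k, toggleability p (rowmotion^[k] I) =
      toggleOut p (rowmotion^[k + 1] I) - toggleOut p (rowmotion^[k] I) := by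
    intro k
    rw [Function.iterate_succ_apply', toggleOut_rowmotion]
    rfl
  simp only [h]
  rw [Finset.sum_range_sub (fun k => toggleOut p (rowmotion^[k] I)),
    Function.iterate_minimalPeriod]
  simp

lemma toggleSpan_le_homomesicSpace : toggleSpan P ≤ homomesicSpace P := by
  rw [toggleSpan, Submodule.span_le]
  rintro f (rfl | ⟨p, rfl⟩)
  · refine ⟨1, fun I => ?_⟩
    simp
  · exact ⟨0, isMesic_toggleability p⟩

/-- Rowmotion drops out here: the homomesy condition is implied by membership in `toggleSpan`. -/
lemma antichainToggleSpace_eq :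
    antichainToggleSpace P =
      Submodule.span ℝ (Set.range (toggleOut (P := P))) ⊓ toggleSpan P := by
  rw [antichainToggleSpace, homomesicAntichainSpace, inf_assoc,
    inf_eq_right.2 toggleSpan_le_homomesicSpace]

lemma idealToggleSpace_eq :
    idealToggleSpace P =
      Submodule.span ℝ (Set.range (idealIndicator (P := P))) ⊓ toggleSpan P := by
  rw [idealToggleSpace, homomesicIdealSpace, inf_assoc,
    inf_eq_right.2 toggleSpan_le_homomesicSpace]

/-- Adding `p` to an order ideal and removing it again are mutually inverse, so the toggleability
statistic of `p` detects the change of a function when `p` is added. -/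
lemma sum_toggleability_mul [Fintype (LowerSet P)] (p : P) (g : LowerSet P → ℝ) (a : ℝ)
    (hg : ∀ I J : LowerSet P, p ∉ I → (J : Set P) = insert p (I : Set P) → g I - g J = a) :
    ∑ I, toggleability p I * g I = a * ∑ I, toggleIn p I := by
  classical
  -- Reindex the ideals with `p` maximal by removing `p`; the value of `g` at the larger ideal is `g
  -- - a` at the smaller one.
  have hout : ∑ I, toggleOut p I * g I = ∑ I, toggleIn p I * (g I - a) := by
    simp only [toggleIn, toggleOut, ite_mul, one_mul, zero_mul]
    rw [← Finset.sum_filter, ← Finset.sum_filter]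
    have hdiff : ∀ I : LowerSet P, Maximal (fun q => q ∈ I) p → IsLowerSet ((I : Set P) \ {p}) := by
      intro I hI x y hyx hx
      refine ⟨I.lower hyx hx.1, ?_⟩
      rintro rfl
      exact hx.2 (le_antisymm (hI.2 hx.1 hyx) hyx)
    refine Finset.sum_bij' (fun I hI => (⟨(I : Set P) \ {p}, ?_⟩ : LowerSet P))
      (fun I hI => (⟨insert p (I : Set P), ?_⟩ : LowerSet P)) ?_ ?_ ?_ ?_ ?_
    · exact hdiff I (Finset.mem_filter.1 hI).2
    · exact (Finset.mem_filter.1 hI).2.2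
    · intro I hI
      have hI := (Finset.mem_filter.1 hI).2
      refine Finset.mem_filter.2 ⟨Finset.mem_univ _, fun h => h.2 rfl, ?_⟩
      have : insert p ((I : Set P) \ {p}) = I := Set.insert_sdiff_self_of_mem hI.1
      show IsLowerSet (insert p ((I : Set P) \ {p}))
      rw [this]
      exact I.lower
    · intro I hI
      have hI := (Finset.mem_filter.1 hI).2
      refine Finset.mem_filter.2 ⟨Finset.mem_univ _, Set.mem_insert _ _, ?_⟩
      rintro q (rfl | hq) hpq
      · exact le_rfl
      · exact absurd (I.lower hpq hq) hI.1
    · intro I hI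
      have hI := (Finset.mem_filter.1 hI).2
      exact SetLike.coe_injective (Set.insert_sdiff_self_of_mem hI.1)
    · intro I hI
      have hI := (Finset.mem_filter.1 hI).2
      exact SetLike.coe_injective (Set.insert_sdiff_self_of_notMem hI.1)
    · intro I hI
      have hI := (Finset.mem_filter.1 hI).2
      have h := hg ⟨(I : Set P) \ {p}, hdiff I hI⟩ I
        (fun h => (h : p ∈ (I : Set P) \ {p}).2 rfl) (Set.insert_sdiff_self_of_mem hI.1).symm
      linarith
  simp only [toggleability, Pi.sub_apply, sub_mul, Finset.sum_sub_distrib, hout, mul_sub,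
    ← Finset.sum_mul]
  ring

/-- The combination of a constant and of the toggleability statistics with coefficients `c`,
normalised to vanish at the empty order ideal when `P` has a least element. -/
def toggleCombination [Fintype P] [OrderBot P] : (P → ℝ) →ₗ[ℝ] (LowerSet P → ℝ) where
  toFun c := fun I => -c ⊥ + ∑ p, c p * toggleability p I
  map_add' c d := by
    ext I
    simp only [Pi.add_apply, add_mul, Finset.sum_add_distrib]
    ring
  map_smul' a c := by
    ext I
    simp only [Pi.smul_apply, smul_eq_mul, RingHom.id_apply, mul_add, Finset.mul_sum]
    ring_nf

lemma sum_toggleIn_pos [Fintype (LowerSet P)] (p : P) : 0 < ∑ I, toggleIn p I := by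
  classical
  refine Finset.sum_pos' (fun I _ => ?_) ⟨LowerSet.Iio p, Finset.mem_univ _, ?_⟩
  · rw [toggleIn]
    positivity
  · rw [toggleIn_apply, if_pos]
    · exact one_pos
    · refine ⟨by simp, fun q hq hqp => ?_⟩
      by_contra h
      exact hq (lt_of_le_not_ge hqp h)

/-- Pairing the relation with a suitable `g` gives a sum of squares `c p ^ 2` with positive weights,
the numbers of ideals to which `p` can be added. -/
lemma eq_zero_of_sum_toggleability [Fintype P] (c₀ : ℝ) (c : P → ℝ)
    (h : ∀ I : LowerSet P, c₀ + ∑ p, c p * toggleability p I = 0) : c = 0 := by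
  classical
  have : Fintype (LowerSet P) := Fintype.ofInjective (fun I : LowerSet P => (I : Set P))
    SetLike.coe_injective
  -- Each toggleability sums to zero over all ideals, so summing the relation isolates the constant.
  have hc₀ : c₀ = 0 := by
    have h1 : ∑ I : LowerSet P, (c₀ + ∑ p, c p * toggleability p I) = 0 :=
      Finset.sum_eq_zero fun I _ => h I
    rw [Finset.sum_add_distrib, Finset.sum_comm] at h1
    have h2 : ∀ p : P, ∑ I : LowerSet P, c p * toggleability p I = 0 := by
      intro p
      have := sum_toggleability_mul p (fun _ => 1) 0 (by simp)
      rw [← Finset.mul_sum]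
      simp only [mul_one, zero_mul] at this
      rw [this, mul_zero]
    simp only [h2, Finset.sum_const_zero, add_zero, Finset.sum_const, nsmul_eq_mul] at h1
    rcases mul_eq_zero.1 h1 with h3 | h3
    · have : Nonempty (LowerSet P) := ⟨⊥⟩
      simp at h3
    · exact h3
  subst hc₀
  -- Chosen so that adding `p` lowers `g` by exactly `c p`.
  set g : LowerSet P → ℝ := fun I => -∑ q, c q * idealIndicator q I with hgdef
  have hg : ∀ p, ∑ I, toggleability p I * g I = c p * ∑ I, toggleIn p I := by
    intro p
    refine sum_toggleability_mul p g (c p) fun I J hp hJ => ?_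
    have hmem : ∀ q, q ∈ J ↔ q = p ∨ q ∈ I := fun q => by
      rw [← SetLike.mem_coe, hJ, Set.mem_insert_iff, SetLike.mem_coe]
    have : ∀ q, c q * idealIndicator q J - c q * idealIndicator q I = if q = p then c p else 0 := by
      intro q
      by_cases hq : q = p
      · subst hq
        simp [idealIndicator, hp, hmem]
      · simp [idealIndicator, hmem, hq]
    simp only [hgdef]
    rw [neg_sub_neg, ← Finset.sum_sub_distrib]
    simp [this]
  have hsum : ∑ p, c p ^ 2 * ∑ I, toggleIn p I = 0 := by
    calc ∑ p, c p ^ 2 * ∑ I, toggleIn p I = ∑ p, ∑ I, c p * (toggleability p I * g I) := by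
          refine Finset.sum_congr rfl fun p _ => ?_
          rw [← Finset.mul_sum, hg]
          ring
      _ = ∑ I, (0 + ∑ p, c p * toggleability p I) * g I := by
          rw [Finset.sum_comm]
          refine Finset.sum_congr rfl fun I _ => ?_
          rw [zero_add, Finset.sum_mul]
          exact Finset.sum_congr rfl fun p _ => by ring
      _ = 0 := Finset.sum_eq_zero fun I _ => by rw [h I, zero_mul]
  rw [Finset.sum_eq_zero_iff_of_nonneg fun p _ =>
    mul_nonneg (sq_nonneg _) (sum_toggleIn_pos p).le] at hsum
  ext p
  have := hsum p (Finset.mem_univ p)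
  rcases mul_eq_zero.1 this with h1 | h1
  · simpa using h1
  · exact absurd h1 (sum_toggleIn_pos p).ne'

lemma toggleCombination_injective [Fintype P] [OrderBot P] :
    Function.Injective (toggleCombination (P := P)) := by
  rw [injective_iff_map_eq_zero]
  intro c hc
  exact eq_zero_of_sum_toggleability (-c ⊥) c fun I => congrFun hc I

lemma mem_toggleSpan_iff [Fintype P] (f : LowerSet P → ℝ) :
    f ∈ toggleSpan P ↔ ∃ (c₀ : ℝ) (c : P → ℝ), f = fun I => c₀ + ∑ p, c p * toggleability p I := by
  rw [toggleSpan, Submodule.mem_span_insert]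
  constructor
  · rintro ⟨a, z, hz, rfl⟩
    obtain ⟨c, rfl⟩ := (Submodule.mem_span_range_iff_exists_fun ℝ).1 hz
    refine ⟨a, c, ?_⟩
    ext I
    simp [Finset.sum_apply]
  · rintro ⟨a, c, rfl⟩
    refine ⟨a, ∑ p, c p • toggleability p,
      (Submodule.mem_span_range_iff_exists_fun ℝ).2 ⟨c, rfl⟩, ?_⟩
    ext I
    simp [Finset.sum_apply]

lemma toggleOut_bot (p : P) : toggleOut p (⊥ : LowerSet P) = 0 := by
  rw [toggleOut_apply, if_neg fun h => h.1]

lemma apply_bot_of_mem_span_toggleOut {f : LowerSet P → ℝ}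
    (hf : f ∈ Submodule.span ℝ (Set.range (toggleOut (P := P)))) : f ⊥ = 0 := by
  have : Submodule.span ℝ (Set.range (toggleOut (P := P))) ≤
      LinearMap.ker (LinearMap.proj (R := ℝ) (φ := fun _ => ℝ) (⊥ : LowerSet P)) := by
    rw [Submodule.span_le]
    rintro _ ⟨q, rfl⟩
    exact toggleOut_bot q
  exact this hf

end ToggleGeneral

/-! ### A dimension count for triangular systems -/

/-- Coordinates outside `N` determine the rest by induction along the order, which bounds the
dimension above. Rank-nullity for the system of equations indexed by `N` bounds it below. -/
lemma finrank_triangular {P : Type u} [PartialOrder P] [Fintype P] (N : Set P)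
    (V : Submodule ℝ (P → ℝ)) (L : N → ((P → ℝ) →ₗ[ℝ] ℝ))
    (hV : ∀ c, c ∈ V ↔ ∀ x : N, c x = L x c)
    (hL : ∀ (x : N) (c : P → ℝ), (∀ y ∉ N, c y = 0) → (∀ y < (x : P), c y = 0) → L x c = 0) :
    Module.finrank ℝ V = Nat.card (Nᶜ : Set P) := by
  classical
  have hcard : Nat.card N + Nat.card (Nᶜ : Set P) = Fintype.card P := by
    rw [← Nat.card_eq_fintype_card, ← Nat.card_sum]
    exact Nat.card_congr (Equiv.Set.sumCompl N)
  apply le_antisymm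
  · have hinj : Function.Injective
        ((LinearMap.funLeft ℝ ℝ (fun y : (Nᶜ : Set P) => (y : P))).comp V.subtype) := by
      rw [injective_iff_map_eq_zero]
      rintro ⟨c, hc⟩ h0
      have hN : ∀ y ∉ N, c y = 0 := fun y hy => congrFun h0 ⟨y, hy⟩
      have hall : ∀ y, c y = 0 := by
        intro y
        induction y using WellFoundedLT.induction with
        | ind y ih =>
          by_cases hy : y ∈ N
          · rw [(hV c).1 hc ⟨y, hy⟩]
            exact hL ⟨y, hy⟩ c hN ih
          · exact hN y hy
      exact Subtype.ext (funext hall)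
    have := LinearMap.finrank_le_finrank_of_injective hinj
    rwa [Module.finrank_fintype_fun_eq_card, ← Nat.card_eq_fintype_card] at this
  · set φ : (P → ℝ) →ₗ[ℝ] (N → ℝ) :=
      LinearMap.pi fun x => LinearMap.proj (x : P) - L x with hφ
    have hker : LinearMap.ker φ = V := by
      ext c
      rw [hV, LinearMap.mem_ker, funext_iff]
      exact forall_congr' fun x => sub_eq_zero
    have h1 := LinearMap.finrank_range_add_finrank_ker φ
    have h2 := Submodule.finrank_le (LinearMap.range φ)
    rw [Module.finrank_fintype_fun_eq_card, ← Nat.card_eq_fintype_card] at h2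
    rw [hker, Module.finrank_fintype_fun_eq_card] at h1
    omega

/-! ### Statistics on the order ideals of a distributive lattice with few covers -/

section Covers

variable {P : Type u} [DistribLattice P]

/-- `x` covers two distinct elements. -/
def HasTwoLowerCovers (x : P) : Prop :=
  ∃ u v : P, u ⋖ x ∧ v ⋖ x ∧ u ≠ v

open Classical in
/-- One of two distinct elements covered by `x`, if there are two. -/
def firstLowerCover (x : P) : P :=
  if h : HasTwoLowerCovers x then h.choose else x

open Classical in
/-- The other one of two distinct elements covered by `x`, if there are two. -/
def secondLowerCover (x : P) : P :=
  if h : HasTwoLowerCovers x then h.choose_spec.choose else x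

/-- The bottom of the square with top `x`. -/
def squareBottom (x : P) : P :=
  firstLowerCover x ⊓ secondLowerCover x

variable (P) in
/-- No element covers, or is covered by, more than two elements. -/
def AtMostTwoCovers : Prop :=
  (∀ x u v w : P, u ⋖ x → v ⋖ x → w ⋖ x → u = v ∨ v = w ∨ u = w) ∧
    ∀ x u v w : P, x ⋖ u → x ⋖ v → x ⋖ w → u = v ∨ v = w ∨ u = w

variable {x y : P}

lemma firstLowerCover_covBy (h : HasTwoLowerCovers x) : firstLowerCover x ⋖ x := by
  rw [firstLowerCover, dif_pos h]
  exact h.choose_spec.choose_spec.1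

lemma secondLowerCover_covBy (h : HasTwoLowerCovers x) : secondLowerCover x ⋖ x := by
  rw [secondLowerCover, dif_pos h]
  exact h.choose_spec.choose_spec.2.1

lemma firstLowerCover_ne (h : HasTwoLowerCovers x) : firstLowerCover x ≠ secondLowerCover x := by
  rw [firstLowerCover, secondLowerCover, dif_pos h, dif_pos h]
  exact h.choose_spec.choose_spec.2.2

lemma CovBy.not_le_of_ne {u v x : P} (hu : u ⋖ x) (hv : v ⋖ x) (huv : u ≠ v) : ¬ u ≤ v :=
  fun h => hu.2 (lt_of_le_of_ne h huv) hv.lt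

lemma firstLowerCover_not_le (h : HasTwoLowerCovers x) :
    ¬ firstLowerCover x ≤ secondLowerCover x :=
  (firstLowerCover_covBy h).not_le_of_ne (secondLowerCover_covBy h) (firstLowerCover_ne h)

lemma secondLowerCover_not_le (h : HasTwoLowerCovers x) :
    ¬ secondLowerCover x ≤ firstLowerCover x :=
  (secondLowerCover_covBy h).not_le_of_ne (firstLowerCover_covBy h) (firstLowerCover_ne h).symm

lemma firstLowerCover_sup (h : HasTwoLowerCovers x) :
    firstLowerCover x ⊔ secondLowerCover x = x :=
  (firstLowerCover_covBy h).wcovBy.sup_eq (secondLowerCover_covBy h).wcovBy (firstLowerCover_ne h)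

lemma squareBottom_lt (h : HasTwoLowerCovers x) : squareBottom x < x :=
  inf_le_left.trans_lt (firstLowerCover_covBy h).lt

lemma AtMostTwoCovers.eq_or_eq (hP : AtMostTwoCovers P) (h : HasTwoLowerCovers x) {w : P}
    (hw : w ⋖ x) : w = firstLowerCover x ∨ w = secondLowerCover x := by
  rcases hP.1 x w _ _ hw (firstLowerCover_covBy h) (secondLowerCover_covBy h) with h1 | h1 | h1
  · exact Or.inl h1
  · exact absurd h1 (firstLowerCover_ne h)
  · exact Or.inr h1

/-- The product of the indicators of the two elements covered by `x`. -/
def squareIndicator (x : P) : LowerSet P → ℝ :=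
  idealIndicator (firstLowerCover x) * idealIndicator (secondLowerCover x)

/-- The second difference of a statistic at the square with top `x`. -/
def squareDifference (x : P) : (LowerSet P → ℝ) →ₗ[ℝ] ℝ :=
  LinearMap.proj (R := ℝ) (φ := fun _ : LowerSet P => ℝ)
      (LowerSet.Iic (firstLowerCover x) ⊔ LowerSet.Iic (secondLowerCover x)) -
    LinearMap.proj (LowerSet.Iic (firstLowerCover x)) -
    LinearMap.proj (LowerSet.Iic (secondLowerCover x)) +
    LinearMap.proj (LowerSet.Iic (squareBottom x))

lemma squareDifference_apply (x : P) (f : LowerSet P → ℝ) :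
    squareDifference x f =
      f (LowerSet.Iic (firstLowerCover x) ⊔ LowerSet.Iic (secondLowerCover x)) -
        f (LowerSet.Iic (firstLowerCover x)) - f (LowerSet.Iic (secondLowerCover x)) +
        f (LowerSet.Iic (squareBottom x)) :=
  rfl

lemma squareDifference_one (x : P) : squareDifference x (1 : LowerSet P → ℝ) = 0 := by
  simp [squareDifference_apply]

/-- The ideal below `squareBottom x` is the intersection of the two principal ideals, so this is
inclusion-exclusion. -/
lemma squareDifference_idealIndicator (x q : P) : squareDifference x (idealIndicator q) = 0 := by
  simp only [squareDifference_apply, idealIndicator, LowerSet.mem_sup_iff, LowerSet.mem_Iic_iff,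
    squareBottom, le_inf_iff]
  by_cases h1 : q ≤ firstLowerCover x <;> by_cases h2 : q ≤ secondLowerCover x <;> simp [h1, h2]

lemma toggleOut_Iic (y z : P) [Decidable (y = z)] :
    toggleOut y (LowerSet.Iic z) = if y = z then 1 else 0 := by
  classical
  rw [toggleOut_apply]
  refine if_congr ⟨fun h => ?_, ?_⟩ rfl rfl
  · exact le_antisymm h.1 (h.2 (show z ∈ LowerSet.Iic z from le_rfl) h.1)
  · rintro rfl
    exact ⟨le_refl y, fun w hw _ => hw⟩

lemma toggleOut_Iic_sup_Iic (y : P) {u v : P} (huv : ¬ u ≤ v) (hvu : ¬ v ≤ u)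
    [Decidable (y = u)] [Decidable (y = v)] :
    toggleOut y (LowerSet.Iic u ⊔ LowerSet.Iic v) =
      (if y = u then 1 else 0) + if y = v then 1 else 0 := by
  classical
  have h : Maximal (fun q => q ∈ LowerSet.Iic u ⊔ LowerSet.Iic v) y ↔ y = u ∨ y = v := by
    constructor
    · intro h
      rcases LowerSet.mem_sup_iff.1 h.1 with h1 | h1
      · exact Or.inl (le_antisymm h1 (h.2 (LowerSet.mem_sup_iff.2 (Or.inl le_rfl)) h1))
      · exact Or.inr (le_antisymm h1 (h.2 (LowerSet.mem_sup_iff.2 (Or.inr le_rfl)) h1))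
    · rintro (rfl | rfl)
      · refine ⟨LowerSet.mem_sup_iff.2 (Or.inl le_rfl), fun w hw hyw => ?_⟩
        rcases LowerSet.mem_sup_iff.1 hw with h1 | h1
        · exact h1
        · exact absurd (hyw.trans h1) huv
      · refine ⟨LowerSet.mem_sup_iff.2 (Or.inr le_rfl), fun w hw hyw => ?_⟩
        rcases LowerSet.mem_sup_iff.1 hw with h1 | h1
        · exact absurd (hyw.trans h1) hvu
        · exact h1
  rw [toggleOut_apply]
  by_cases h1 : y = u
  · rw [if_pos (h.2 (Or.inl h1)), if_pos h1, if_neg, add_zero]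
    rintro rfl
    exact huv h1.ge
  · by_cases h2 : y = v
    · rw [if_pos (h.2 (Or.inr h2)), if_neg h1, if_pos h2, zero_add]
    · rw [if_neg (fun h' => (h.1 h').elim h1 h2), if_neg h1, if_neg h2, zero_add]

/-- The maximal elements of the four ideals are their generators, so the contributions of the two
covers cancel and only the bottom remains. -/
lemma squareDifference_toggleOut (hx : HasTwoLowerCovers x) [Decidable (y = squareBottom x)] :
    squareDifference x (toggleOut y) = if y = squareBottom x then 1 else 0 := by
  classical
  rw [squareDifference_apply, toggleOut_Iic, toggleOut_Iic, toggleOut_Iic,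
    toggleOut_Iic_sup_Iic y (firstLowerCover_not_le hx) (secondLowerCover_not_le hx)]
  ring

/-- For `y ≠ x`, each of the four ideals contains both chosen lower covers of `y` only if it
contains `y`. There the product agrees with the indicator of `y`, whose second difference vanishes.
-/
lemma AtMostTwoCovers.squareDifference_squareIndicator [Finite P] (hP : AtMostTwoCovers P)
    (hx : HasTwoLowerCovers x) (hy : HasTwoLowerCovers y) [Decidable (x = y)] :
    squareDifference x (squareIndicator y) = if x = y then 1 else 0 := by
  by_cases hxy : x = y
  · subst hxy
    have h1 := firstLowerCover_not_le hx
    have h2 := secondLowerCover_not_le hx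
    simp [squareDifference_apply, squareIndicator, idealIndicator, squareBottom, h1, h2]
  · rw [if_neg hxy]
    have hle : ∀ t : P, ¬ (firstLowerCover y ≤ t ∧ secondLowerCover y ≤ t ∧ ¬ y ≤ t) := by
      rintro t ⟨h1, h2, h3⟩
      exact h3 ((firstLowerCover_sup hy).ge.trans (sup_le h1 h2))
    -- The union of two principal ideals is the delicate case: `y < x` lies below some lower cover
    -- of `x`, and there is no third one.
    have key : firstLowerCover y ≤ firstLowerCover x ∨ firstLowerCover y ≤ secondLowerCover x →
        secondLowerCover y ≤ firstLowerCover x ∨ secondLowerCover y ≤ secondLowerCover x →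
        y ≤ firstLowerCover x ∨ y ≤ secondLowerCover x := by
      intro h1 h2
      have hfx := (firstLowerCover_covBy hx).le
      have hsx := (secondLowerCover_covBy hx).le
      have hyx : y ≤ x := by
        rw [← firstLowerCover_sup hy]
        exact sup_le (h1.elim (·.trans hfx) (·.trans hsx)) (h2.elim (·.trans hfx) (·.trans hsx))
      obtain ⟨t, hyt, htx⟩ := exists_le_covBy_of_lt (lt_of_le_of_ne hyx (Ne.symm hxy))
      rcases hP.eq_or_eq hx htx with rfl | rfl
      · exact Or.inl hyt
      · exact Or.inr hyt
    have hfy := (firstLowerCover_covBy hy).le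
    have hsy := (secondLowerCover_covBy hy).le
    have e1 : ∀ t : P, (firstLowerCover y ≤ t ∧ secondLowerCover y ≤ t) ↔ y ≤ t := fun t =>
      ⟨fun h => by_contra fun h' => hle t ⟨h.1, h.2, h'⟩,
        fun h => ⟨hfy.trans h, hsy.trans h⟩⟩
    have e2 : (firstLowerCover y ∈
          LowerSet.Iic (firstLowerCover x) ⊔ LowerSet.Iic (secondLowerCover x) ∧
        secondLowerCover y ∈
          LowerSet.Iic (firstLowerCover x) ⊔ LowerSet.Iic (secondLowerCover x)) ↔
        y ∈ LowerSet.Iic (firstLowerCover x) ⊔ LowerSet.Iic (secondLowerCover x) :=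
      ⟨fun h => key h.1 h.2, fun h => ⟨LowerSet.lower _ hfy h, LowerSet.lower _ hsy h⟩⟩
    have hI : ∀ I : LowerSet P, ((firstLowerCover y ∈ I ∧ secondLowerCover y ∈ I) ↔ y ∈ I) →
        squareIndicator y I = idealIndicator y I := by
      intro I h
      by_cases h1 : firstLowerCover y ∈ I <;> by_cases h2 : secondLowerCover y ∈ I <;>
        simp [squareIndicator, idealIndicator, ← h, h1, h2]
    rw [← squareDifference_idealIndicator x y]
    simp only [squareDifference_apply]
    rw [hI _ e2, hI (LowerSet.Iic _) (e1 _), hI (LowerSet.Iic _) (e1 _),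
      hI (LowerSet.Iic _) (e1 _)]

end Covers

/-! ### Expansion of toggle statistics in indicators and square products -/

section ToggleFormulas

variable {P : Type u} [DistribLattice P] {x y : P}

lemma minimal_notMem_iff_covBy [Finite P] (p : P) (I : LowerSet P) :
    Minimal (fun q => q ∉ I) p ↔ p ∉ I ∧ ∀ w, w ⋖ p → w ∈ I := by
  constructor
  · intro h
    exact ⟨h.1, fun w hw => by_contra fun h' => hw.lt.not_ge (h.2 h' hw.le)⟩
  · rintro ⟨h1, h2⟩
    refine ⟨h1, fun q hq hqp => ?_⟩
    rcases hqp.eq_or_lt with rfl | hlt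
    · exact le_rfl
    · obtain ⟨w, hqw, hw⟩ := exists_le_covBy_of_lt hlt
      exact absurd (I.lower hqw (h2 w hw)) hq

lemma maximal_mem_iff_covBy [Finite P] (p : P) (I : LowerSet P) :
    Maximal (fun q => q ∈ I) p ↔ p ∈ I ∧ ∀ u, p ⋖ u → u ∉ I := by
  constructor
  · intro h
    exact ⟨h.1, fun w hw h' => hw.lt.not_ge (h.2 h' hw.le)⟩
  · rintro ⟨h1, h2⟩
    refine ⟨h1, fun q hq hqp => ?_⟩
    rcases hqp.eq_or_lt with rfl | hlt
    · exact le_rfl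
    · obtain ⟨w, hw, hqw⟩ := exists_covBy_le_of_lt hlt
      exact absurd (I.lower hqw hq) (h2 w hw)

lemma toggleIn_bot [Finite P] [OrderBot P] : toggleIn (⊥ : P) = 1 - idealIndicator ⊥ := by
  ext I
  classical
  rw [toggleIn_apply]
  simp only [minimal_notMem_iff_covBy, not_covBy_bot, false_imp_iff, implies_true, and_true]
  by_cases h : ⊥ ∈ I <;> simp [idealIndicator, h]

lemma exists_toggleIn_eq [Finite P] [OrderBot P] (hx : ¬ HasTwoLowerCovers x) (h0 : x ≠ ⊥) :
    ∃ w, toggleIn x = idealIndicator w - idealIndicator x := by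
  obtain ⟨w, -, hw⟩ := exists_le_covBy_of_lt (bot_lt_iff_ne_bot.2 h0)
  refine ⟨w, ?_⟩
  have huniq : ∀ v, v ⋖ x ↔ v = w := by
    refine fun v => ⟨fun hv => ?_, fun h => h ▸ hw⟩
    by_contra hne
    exact hx ⟨v, w, hv, hw, hne⟩
  ext I
  classical
  rw [toggleIn_apply]
  simp only [minimal_notMem_iff_covBy, huniq, forall_eq]
  by_cases h : x ∈ I
  · have h' : w ∈ I := I.lower hw.le h
    simp [idealIndicator, h, h']
  · by_cases h' : w ∈ I <;> simp [idealIndicator, h, h']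

lemma AtMostTwoCovers.toggleIn_eq [Finite P] (hP : AtMostTwoCovers P) (hx : HasTwoLowerCovers x) :
    toggleIn x = squareIndicator x - idealIndicator x := by
  classical
  ext I
  have h1 : (∀ w, w ⋖ x → w ∈ I) ↔ firstLowerCover x ∈ I ∧ secondLowerCover x ∈ I := by
    refine ⟨fun h => ⟨h _ (firstLowerCover_covBy hx), h _ (secondLowerCover_covBy hx)⟩,
      fun h w hw => ?_⟩
    rcases hP.eq_or_eq hx hw with rfl | rfl
    exacts [h.1, h.2]
  classical
  rw [toggleIn_apply]
  simp only [minimal_notMem_iff_covBy, h1]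
  by_cases h : x ∈ I
  · have h1 : firstLowerCover x ∈ I := I.lower (firstLowerCover_covBy hx).le h
    have h2 : secondLowerCover x ∈ I := I.lower (secondLowerCover_covBy hx).le h
    simp [squareIndicator, idealIndicator, h, h1, h2]
  · by_cases h1 : firstLowerCover x ∈ I <;> by_cases h2 : secondLowerCover x ∈ I <;>
      simp [squareIndicator, idealIndicator, h, h1, h2]

/-- By modularity two upper covers of `x` are lower covers of their join. The product arising in
`toggleOut x` is therefore again a square product, for the square with bottom `x`. -/
lemma AtMostTwoCovers.squareIndicator_sup (hP : AtMostTwoCovers P) {u v : P} (hu : x ⋖ u)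
    (hv : x ⋖ v) (huv : u ≠ v) : HasTwoLowerCovers (u ⊔ v) ∧
      squareIndicator (u ⊔ v) = idealIndicator u * idealIndicator v := by
  have hinf : u ⊓ v = x := hu.wcovBy.inf_eq hv.wcovBy huv
  have hu' : u ⋖ u ⊔ v := CovBy.sup_of_inf_right (hinf.symm ▸ hv)
  have hv' : v ⋖ u ⊔ v := CovBy.sup_of_inf_left (hinf.symm ▸ hu)
  have h2 : HasTwoLowerCovers (u ⊔ v) := ⟨u, v, hu', hv', huv⟩
  refine ⟨h2, ?_⟩
  rcases hP.eq_or_eq h2 hu' with h | h <;> rcases hP.eq_or_eq h2 hv' with h' | h'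
  · exact absurd (h.trans h'.symm) huv
  · rw [squareIndicator, ← h, ← h']
  · rw [squareIndicator, ← h, ← h', mul_comm]
  · exact absurd (h.trans h'.symm) huv

variable (P) in
/-- The span of the constants, the indicators, and the products of two indicators at a square. -/
def squareSpan : Submodule ℝ (LowerSet P → ℝ) :=
  Submodule.span ℝ {1} ⊔ Submodule.span ℝ (Set.range (idealIndicator (P := P))) ⊔
    Submodule.span ℝ (Set.range fun x : {x : P // HasTwoLowerCovers x} => squareIndicator (x : P))

lemma one_mem_squareSpan : (1 : LowerSet P → ℝ) ∈ squareSpan P :=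
  Submodule.mem_sup_left (Submodule.mem_sup_left (Submodule.mem_span_singleton_self _))

lemma idealIndicator_mem_squareSpan (x : P) : idealIndicator x ∈ squareSpan P :=
  Submodule.mem_sup_left (Submodule.mem_sup_right (Submodule.subset_span ⟨x, rfl⟩))

lemma squareIndicator_mem_squareSpan (hx : HasTwoLowerCovers x) :
    squareIndicator x ∈ squareSpan P :=
  Submodule.mem_sup_right (Submodule.subset_span ⟨⟨x, hx⟩, rfl⟩)

lemma AtMostTwoCovers.toggleIn_mem_squareSpan [Finite P] [OrderBot P] (hP : AtMostTwoCovers P) (x : P) :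
    toggleIn x ∈ squareSpan P := by
  by_cases h0 : x = ⊥
  · rw [h0, toggleIn_bot]
    exact sub_mem one_mem_squareSpan (idealIndicator_mem_squareSpan _)
  · by_cases hx : HasTwoLowerCovers x
    · rw [hP.toggleIn_eq hx]
      exact sub_mem (squareIndicator_mem_squareSpan hx) (idealIndicator_mem_squareSpan _)
    · obtain ⟨w, hw⟩ := exists_toggleIn_eq hx h0
      rw [hw]
      exact sub_mem (idealIndicator_mem_squareSpan _) (idealIndicator_mem_squareSpan _)

lemma AtMostTwoCovers.toggleOut_mem_squareSpan [Finite P] (hP : AtMostTwoCovers P) (x : P) :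
    toggleOut x ∈ squareSpan P := by
  by_cases h0 : ∃ u, x ⋖ u
  · obtain ⟨u, hu⟩ := h0
    by_cases h1 : ∃ v, x ⋖ v ∧ u ≠ v
    · obtain ⟨v, hv, huv⟩ := h1
      obtain ⟨h2, h3⟩ := hP.squareIndicator_sup hu hv huv
      -- Inclusion-exclusion over the two upper covers: `x` is maximal in an ideal when it is
      -- present and neither cover is.
      have : toggleOut x = idealIndicator x - idealIndicator u - idealIndicator v +
          squareIndicator (u ⊔ v) := by
        have hc : ∀ w, x ⋖ w ↔ w = u ∨ w = v := by
          refine fun w => ⟨fun hw => ?_, ?_⟩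
          · rcases hP.2 x u v w hu hv hw with h | h | h
            exacts [absurd h huv, Or.inr h.symm, Or.inl h.symm]
          · rintro (rfl | rfl) <;> assumption
        ext I
        classical
        rw [h3, toggleOut_apply]
        simp only [maximal_mem_iff_covBy, hc, forall_eq_or_imp, forall_eq]
        by_cases h : x ∈ I
        · by_cases h1 : u ∈ I <;> by_cases h2 : v ∈ I <;> simp [idealIndicator, h, h1, h2]
        · have h1 : u ∉ I := fun h' => h (I.lower hu.le h')
          have h2 : v ∉ I := fun h' => h (I.lower hv.le h')
          simp [idealIndicator, h, h1, h2]
      rw [this]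
      exact add_mem (sub_mem (sub_mem (idealIndicator_mem_squareSpan _)
        (idealIndicator_mem_squareSpan _)) (idealIndicator_mem_squareSpan _))
        (squareIndicator_mem_squareSpan h2)
    · push Not at h1
      have hc : ∀ w, x ⋖ w ↔ w = u := fun w => ⟨fun hw => (h1 w hw).symm, fun h => h ▸ hu⟩
      have : toggleOut x = idealIndicator x - idealIndicator u := by
        ext I
        classical
        rw [toggleOut_apply]
        simp only [maximal_mem_iff_covBy, hc, forall_eq]
        by_cases h : x ∈ I
        · by_cases h1 : u ∈ I <;> simp [idealIndicator, h, h1]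
        · have h1 : u ∉ I := fun h' => h (I.lower hu.le h')
          simp [idealIndicator, h, h1]
      rw [this]
      exact sub_mem (idealIndicator_mem_squareSpan _) (idealIndicator_mem_squareSpan _)
  · push Not at h0
    have : toggleOut x = idealIndicator x := by
      ext I
      classical
      rw [toggleOut_apply]
      simp [maximal_mem_iff_covBy, h0, idealIndicator]
    rw [this]
    exact idealIndicator_mem_squareSpan _

lemma AtMostTwoCovers.squareDifference_toggleIn [Finite P] [OrderBot P] (hP : AtMostTwoCovers P)
    (hx : HasTwoLowerCovers x) [Decidable (x = y)] :
    squareDifference x (toggleIn y) = if x = y then 1 else 0 := by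
  by_cases hy : HasTwoLowerCovers y
  · rw [hP.toggleIn_eq hy, map_sub, hP.squareDifference_squareIndicator hx hy,
      squareDifference_idealIndicator, sub_zero]
  · rw [if_neg fun h : x = y => hy (h ▸ hx)]
    by_cases h0 : y = ⊥
    · rw [h0, toggleIn_bot, map_sub, squareDifference_one, squareDifference_idealIndicator,
        sub_zero]
    · obtain ⟨w, hw⟩ := exists_toggleIn_eq hy h0
      rw [hw, map_sub, squareDifference_idealIndicator, squareDifference_idealIndicator, sub_zero]

/-- A principal ideal containing both lower covers contains their join `x`. This keeps the dependent
coordinates out of the right-hand sides of the antichain equations. -/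
lemma toggleIn_Iic_eq_zero [Finite P] (hx : HasTwoLowerCovers x) (z : P) :
    toggleIn x (LowerSet.Iic z) = 0 := by
  rw [toggleIn_apply, if_neg]
  rw [minimal_notMem_iff_covBy]
  rintro ⟨h1, h2⟩
  refine h1 ?_
  have := sup_le (h2 _ (firstLowerCover_covBy hx)) (h2 _ (secondLowerCover_covBy hx))
  rwa [firstLowerCover_sup hx] at this

lemma span_idealIndicator_le_ker (x : P) :
    Submodule.span ℝ (Set.range (idealIndicator (P := P))) ≤ LinearMap.ker (squareDifference x) := by
  rw [Submodule.span_le]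
  rintro _ ⟨q, rfl⟩
  exact squareDifference_idealIndicator x q

lemma apply_bot_of_mem_span_idealIndicator {f : LowerSet P → ℝ}
    (hf : f ∈ Submodule.span ℝ (Set.range (idealIndicator (P := P)))) : f ⊥ = 0 := by
  have : Submodule.span ℝ (Set.range (idealIndicator (P := P))) ≤
      LinearMap.ker (LinearMap.proj (R := ℝ) (φ := fun _ => ℝ) (⊥ : LowerSet P)) := by
    rw [Submodule.span_le]
    rintro _ ⟨q, rfl⟩
    simp [idealIndicator]
  exact this hf

/-- Second differences are dual to the square products and kill the other generators, so they detect
those coefficients; the empty ideal detects the constant. -/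
lemma AtMostTwoCovers.mem_span_idealIndicator [Finite P] (hP : AtMostTwoCovers P) {f : LowerSet P → ℝ}
    (hf : f ∈ squareSpan P) (h0 : f ⊥ = 0)
    (hd : ∀ x : P, HasTwoLowerCovers x → squareDifference x f = 0) :
    f ∈ Submodule.span ℝ (Set.range (idealIndicator (P := P))) := by
  classical
  have : Fintype P := Fintype.ofFinite P
  obtain ⟨g, hg, k, hk, rfl⟩ := Submodule.mem_sup.1 hf
  obtain ⟨a, ha, l, hl, rfl⟩ := Submodule.mem_sup.1 hg
  obtain ⟨r, rfl⟩ := Submodule.mem_span_singleton.1 ha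
  obtain ⟨c, rfl⟩ := (Submodule.mem_span_range_iff_exists_fun ℝ).1 hk
  have hc : c = 0 := by
    ext x
    have := hd x x.2
    rw [map_add, map_add, map_smul, squareDifference_one, smul_zero, zero_add,
      LinearMap.mem_ker.1 (span_idealIndicator_le_ker (x : P) hl), zero_add, map_sum] at this
    simp only [map_smul, smul_eq_mul] at this
    rw [Finset.sum_eq_single x] at this
    · rwa [hP.squareDifference_squareIndicator x.2 x.2, if_pos rfl, mul_one] at this
    · intro y _ hy
      rw [hP.squareDifference_squareIndicator x.2 y.2, if_neg, mul_zero]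
      exact fun h => hy (Subtype.ext h.symm)
    · simp
  subst hc
  simp only [Pi.zero_apply, zero_smul, Finset.sum_const_zero, add_zero, Pi.add_apply,
    Pi.smul_apply, Pi.one_apply, smul_eq_mul, mul_one,
    apply_bot_of_mem_span_idealIndicator hl] at h0
  subst h0
  simpa using hl

/-- Evaluation at principal ideals is unitriangular in the coefficients. -/
lemma eq_zero_of_mem_span_idealIndicator [Finite P] {f : LowerSet P → ℝ}
    (hf : f ∈ Submodule.span ℝ (Set.range (idealIndicator (P := P))))
    (hz : ∀ z : P, f (LowerSet.Iic z) = 0) : f = 0 := by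
  classical
  have : Fintype P := Fintype.ofFinite P
  obtain ⟨c, rfl⟩ := (Submodule.mem_span_range_iff_exists_fun ℝ).1 hf
  have hc : ∀ x, c x = 0 := by
    intro x
    induction x using WellFoundedLT.induction with
    | ind x ih =>
      have := hz x
      rw [Finset.sum_apply, Finset.sum_eq_single x] at this
      · simpa [idealIndicator] using this
      · intro y _ hyx
        by_cases h : y ≤ x
        · simp [ih y (lt_of_le_of_ne h hyx)]
        · simp [idealIndicator, h]
      · simp
  simp [hc]

/-- A combination of antichain indicators is determined by its values at principal ideals. -/
lemma AtMostTwoCovers.mem_span_toggleOut_iff [Fintype P] (hP : AtMostTwoCovers P)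
    {f : LowerSet P → ℝ} (hf : f ∈ squareSpan P) (h0 : f ⊥ = 0) :
    f ∈ Submodule.span ℝ (Set.range (toggleOut (P := P))) ↔
      ∀ x : P, HasTwoLowerCovers x →
        squareDifference x f = f (LowerSet.Iic (squareBottom x)) := by
  classical
  constructor
  · intro h x hx
    obtain ⟨d, rfl⟩ := (Submodule.mem_span_range_iff_exists_fun ℝ).1 h
    simp [map_sum, squareDifference_toggleOut hx, Finset.sum_apply, toggleOut_Iic]
  · intro h
    -- At principal ideals the antichain indicators are Kronecker deltas, which forces these
    -- coefficients. The hypothesis makes the second differences of the remainder vanish.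
    have hg : f - ∑ y, f (LowerSet.Iic y) • toggleOut y = 0 := by
      apply eq_zero_of_mem_span_idealIndicator
      · apply hP.mem_span_idealIndicator
        · exact sub_mem hf (Submodule.sum_mem _ fun y _ =>
            Submodule.smul_mem _ _ (hP.toggleOut_mem_squareSpan y))
        · simp [h0, Finset.sum_apply, toggleOut_bot]
        · intro x hx
          simp [map_sum, squareDifference_toggleOut hx, h x hx]
      · intro z
        simp [Finset.sum_apply, toggleOut_Iic]
    rw [sub_eq_zero.1 hg]
    exact (Submodule.mem_span_range_iff_exists_fun ℝ).2 ⟨_, rfl⟩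

end ToggleFormulas

/-! ### Dimensions of the two toggleability spaces -/

section Dimension

variable {P : Type u} [DistribLattice P] [OrderBot P]

lemma toggleCombination_eq [Fintype P] (c : P → ℝ) :
    toggleCombination c = (-c ⊥) • 1 + ∑ p, c p • toggleability p := by
  ext I
  simp [toggleCombination, Finset.sum_apply]

lemma toggleCombination_mem_toggleSpan [Fintype P] (c : P → ℝ) :
    toggleCombination c ∈ toggleSpan P :=
  (mem_toggleSpan_iff _).2 ⟨-c ⊥, c, rfl⟩

lemma toggleability_bot (p : P) [Decidable (p = ⊥)] :
    toggleability p (⊥ : LowerSet P) = if p = ⊥ then 1 else 0 := by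
  classical
  have h1 : Minimal (fun q : P => q ∉ (⊥ : LowerSet P)) p ↔ p = ⊥ := by
    simp [← isMin_iff_eq_bot]
  have h2 : ¬ Maximal (fun q : P => q ∈ (⊥ : LowerSet P)) p := fun h => h.1
  rw [toggleability, Pi.sub_apply, toggleIn_apply, toggleOut_apply, if_neg h2, sub_zero]
  exact if_congr h1 rfl rfl

lemma toggleCombination_bot [Fintype P] (c : P → ℝ) :
    toggleCombination c (⊥ : LowerSet P) = 0 := by
  classical
  simp [toggleCombination, toggleability_bot]

lemma AtMostTwoCovers.toggleCombination_mem_squareSpan [Fintype P] (hP : AtMostTwoCovers P)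
    (c : P → ℝ) : toggleCombination c ∈ squareSpan P := by
  rw [toggleCombination_eq]
  exact add_mem (Submodule.smul_mem _ _ one_mem_squareSpan) (Submodule.sum_mem _ fun p _ =>
    Submodule.smul_mem _ _ (sub_mem (hP.toggleIn_mem_squareSpan p)
      (hP.toggleOut_mem_squareSpan p)))

/-- Toggling in contributes at the top of the square and toggling out at its bottom. -/
lemma AtMostTwoCovers.squareDifference_toggleCombination [Fintype P] (hP : AtMostTwoCovers P)
    (c : P → ℝ) {x : P} (hx : HasTwoLowerCovers x) :
    squareDifference x (toggleCombination c) = c x - c (squareBottom x) := by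
  classical
  rw [toggleCombination_eq, map_add, map_smul, squareDifference_one, smul_zero, zero_add, map_sum]
  simp only [map_smul, toggleability, map_sub, hP.squareDifference_toggleIn hx,
    squareDifference_toggleOut hx, smul_eq_mul, mul_sub, mul_ite, mul_one, mul_zero,
    Finset.sum_sub_distrib, Finset.sum_ite_eq, Finset.sum_ite_eq', Finset.mem_univ, if_true]

lemma toggleCombination_Iic [Fintype P] (c : P → ℝ) (z : P) :
    toggleCombination c (LowerSet.Iic z) =
      -c ⊥ + ∑ y, c y * toggleIn y (LowerSet.Iic z) - c z := by
  classical
  simp only [toggleCombination, LinearMap.coe_mk, AddHom.coe_mk, toggleability, Pi.sub_apply,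
    mul_sub, Finset.sum_sub_distrib, toggleOut_Iic, mul_ite, mul_one, mul_zero,
    Finset.sum_ite_eq', Finset.mem_univ, if_true]
  ring

/-- A toggleability combination vanishing at the empty order ideal has the normalised constant. -/
lemma eq_toggleCombination [Fintype P] {f : LowerSet P → ℝ} (hf : f ∈ toggleSpan P)
    (h0 : f ⊥ = 0) : ∃ c, f = toggleCombination c := by
  classical
  obtain ⟨c₀, c, rfl⟩ := (mem_toggleSpan_iff _).1 hf
  simp only [toggleability_bot, mul_ite, mul_one, mul_zero, Finset.sum_ite_eq', Finset.mem_univ,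
    if_true] at h0
  refine ⟨c, ?_⟩
  rw [eq_neg_of_add_eq_zero_left h0]
  rfl

/-- The equations say that `c` agrees at the top and bottom of each square; they are triangular
because the bottom is strictly below the top. -/
theorem AtMostTwoCovers.finrank_idealToggleSpace [Fintype P] (hP : AtMostTwoCovers P) :
    Module.finrank ℝ (idealToggleSpace P) = Nat.card ({x : P | HasTwoLowerCovers x}ᶜ : Set P) := by
  let L : {x : P | HasTwoLowerCovers x} → ((P → ℝ) →ₗ[ℝ] ℝ) := fun x =>
    LinearMap.proj (squareBottom (x : P))
  let V : Submodule ℝ (P → ℝ) :=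
    ⨅ x : {x : P | HasTwoLowerCovers x}, LinearMap.eqLocus (LinearMap.proj (x : P)) (L x)
  have hV : ∀ c, c ∈ V ↔ ∀ x : {x : P | HasTwoLowerCovers x}, c x = L x c := fun c => by
    simp only [V, Submodule.mem_iInf]
    rfl
  rw [← finrank_triangular _ V L hV fun x c _ h => h _ (squareBottom_lt x.2)]
  have hmap : idealToggleSpace P = V.map toggleCombination := by
    rw [idealToggleSpace_eq]
    ext f
    rw [Submodule.mem_inf, Submodule.mem_map]
    constructor
    · rintro ⟨h1, h2⟩
      obtain ⟨c, rfl⟩ := eq_toggleCombination h2 (apply_bot_of_mem_span_idealIndicator h1)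
      refine ⟨c, (hV c).2 fun x => ?_, rfl⟩
      have := span_idealIndicator_le_ker (x : P) h1
      rw [LinearMap.mem_ker, hP.squareDifference_toggleCombination c x.2] at this
      exact sub_eq_zero.1 this
    · rintro ⟨c, hc, rfl⟩
      refine ⟨hP.mem_span_idealIndicator (hP.toggleCombination_mem_squareSpan c)
        (toggleCombination_bot c) fun x hx => ?_, toggleCombination_mem_toggleSpan c⟩
      rw [hP.squareDifference_toggleCombination c hx]
      exact sub_eq_zero.2 ((hV c).1 hc ⟨x, hx⟩)
  rw [hmap]
  exact (LinearEquiv.finrank_eq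
    (Submodule.equivMapOfInjective toggleCombination toggleCombination_injective V)).symm

theorem AtMostTwoCovers.finrank_antichainToggleSpace [Fintype P] (hP : AtMostTwoCovers P) :
    Module.finrank ℝ (antichainToggleSpace P) =
      Nat.card ({x : P | HasTwoLowerCovers x}ᶜ : Set P) := by
  let L : {x : P | HasTwoLowerCovers x} → ((P → ℝ) →ₗ[ℝ] ℝ) := fun x =>
    -LinearMap.proj ⊥ + ∑ y, toggleIn y (LowerSet.Iic (squareBottom (x : P))) • LinearMap.proj y
  have hLapply : ∀ x c, L x c =
      -c ⊥ + ∑ y, c y * toggleIn y (LowerSet.Iic (squareBottom (x : P))) := fun x c => by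
    simp [L, LinearMap.sum_apply, mul_comm]
  let V : Submodule ℝ (P → ℝ) :=
    ⨅ x : {x : P | HasTwoLowerCovers x}, LinearMap.eqLocus (LinearMap.proj (x : P)) (L x)
  have hV : ∀ c, c ∈ V ↔ ∀ x : {x : P | HasTwoLowerCovers x}, c x = L x c := fun c => by
    simp only [V, Submodule.mem_iInf]
    rfl
  have hL : ∀ (x : {x : P | HasTwoLowerCovers x}) (c : P → ℝ),
      (∀ y ∉ {x : P | HasTwoLowerCovers x}, c y = 0) → (∀ y < (x : P), c y = 0) → L x c = 0 := by
    intro x c h1 _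
    rw [hLapply, h1 ⊥ (fun ⟨u, _, hu, _⟩ => not_covBy_bot hu), neg_zero, zero_add]
    refine Finset.sum_eq_zero fun y _ => ?_
    by_cases hy : HasTwoLowerCovers y
    · rw [toggleIn_Iic_eq_zero hy, mul_zero]
    · rw [h1 y hy, zero_mul]
  rw [← finrank_triangular _ V L hV hL]
  have hiff : ∀ c, toggleCombination c ∈ Submodule.span ℝ (Set.range (toggleOut (P := P))) ↔
      c ∈ V := by
    intro c
    rw [hP.mem_span_toggleOut_iff (hP.toggleCombination_mem_squareSpan c)
      (toggleCombination_bot c), hV, Subtype.forall]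
    refine forall₂_congr fun x hx => ?_
    -- The term `c (squareBottom x)` occurs on both sides and cancels, leaving `c x` alone on the
    -- left.
    rw [hP.squareDifference_toggleCombination c hx, toggleCombination_Iic, hLapply,
      sub_left_inj]
  have hmap : antichainToggleSpace P = V.map toggleCombination := by
    rw [antichainToggleSpace_eq]
    ext f
    rw [Submodule.mem_inf, Submodule.mem_map]
    constructor
    · rintro ⟨h1, h2⟩
      obtain ⟨c, rfl⟩ := eq_toggleCombination h2 (apply_bot_of_mem_span_toggleOut h1)
      exact ⟨c, (hiff c).1 h1, rfl⟩
    · rintro ⟨c, hc, rfl⟩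
      exact ⟨(hiff c).2 hc, toggleCombination_mem_toggleSpan c⟩
  rw [hmap]
  exact (LinearEquiv.finrank_eq
    (Submodule.equivMapOfInjective toggleCombination toggleCombination_injective V)).symm

/-! ### The rank of a finite distributive lattice -/

lemma hasTwoLowerCovers_iff [Finite P] (x : P) :
    HasTwoLowerCovers x ↔ x ≠ ⊥ ∧ ¬ SupIrred x := by
  constructor
  · intro h
    refine ⟨?_, fun hs => ?_⟩
    · rintro rfl
      exact not_covBy_bot (firstLowerCover_covBy h)
    · rcases hs.2 (firstLowerCover_sup h) with h1 | h1
      · exact (firstLowerCover_covBy h).ne h1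
      · exact (secondLowerCover_covBy h).ne h1
  · rintro ⟨h0, hs⟩
    rw [not_supIrred] at hs
    rcases hs with h | ⟨b, c, hbc, hb, hc⟩
    · exact absurd (isMin_iff_eq_bot.1 h) h0
    · obtain ⟨u, hbu, hu⟩ := exists_le_covBy_of_lt hb
      obtain ⟨w, hcw, hw⟩ := exists_le_covBy_of_lt hc
      refine ⟨u, w, hu, hw, ?_⟩
      rintro rfl
      exact hu.lt.not_ge (hbc ▸ sup_le hbu hcw)

lemma card_compl_hasTwoLowerCovers [Finite P] :
    Nat.card ({x : P | HasTwoLowerCovers x}ᶜ : Set P) = Nat.card {x : P // SupIrred x} + 1 := by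
  have h : ({x : P | HasTwoLowerCovers x}ᶜ : Set P) = insert ⊥ {x : P | SupIrred x} := by
    ext x
    simp only [Set.mem_compl_iff, Set.mem_ofPred_eq, hasTwoLowerCovers_iff, Set.mem_insert_iff]
    tauto
  rw [h, Nat.card_coe_set_eq, Set.ncard_insert_of_notMem, ← Nat.card_coe_set_eq]
  · rfl
  · exact fun h => h.ne_bot rfl

end Dimension

section Rank

lemma exists_chain_card_of_orderIso {A : Type u} {B : Type v} [PartialOrder A] [PartialOrder B]
    (e : A ≃o B) {n : ℕ} (h : ∃ C : Finset A, IsChain (· ≤ ·) (C : Set A) ∧ C.card = n) :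
    ∃ C : Finset B, IsChain (· ≤ ·) (C : Set B) ∧ C.card = n := by
  obtain ⟨C, hC, rfl⟩ := h
  refine ⟨C.map e.toEquiv.toEmbedding, ?_, Finset.card_map _⟩
  rw [Finset.coe_map]
  exact IsChain.image_of_map_rel _ _ _ (fun x y hxy => e.monotone hxy) hC

lemma posetRank_congr {P : Type u} {P' : Type v} [PartialOrder P] [PartialOrder P'] (e : P ≃o P') :
    posetRank P = posetRank P' := by
  rw [posetRank, posetRank]
  congr 3
  ext n
  exact ⟨exists_chain_card_of_orderIso e, exists_chain_card_of_orderIso e.symm⟩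

/-- Removing a maximal element from a lower set. -/
lemma LowerSet.exists_erase {Q : Type v} [PartialOrder Q] {I : LowerSet Q} {m : Q}
    (hm : Maximal (fun q => q ∈ I) m) : ∃ J : LowerSet Q, (J : Set Q) = (I : Set Q) \ {m} := by
  refine ⟨⟨(I : Set Q) \ {m}, fun x y hyx hx => ⟨I.lower hyx hx.1, ?_⟩⟩, rfl⟩
  rintro rfl
  exact hx.2 (le_antisymm (hm.2 hx.1 hyx) hyx)

lemma exists_chain_le_lowerSet {Q : Type v} [PartialOrder Q] [Finite Q] (n : ℕ) (I : LowerSet Q)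
    (hI : (I : Set Q).ncard = n) :
    ∃ C : Finset (LowerSet Q), IsChain (· ≤ ·) (C : Set (LowerSet Q)) ∧ C.card = n + 1 ∧
      ∀ J ∈ C, J ≤ I := by
  classical
  induction n generalizing I with
  | zero => exact ⟨{I}, by simp, by simp, by simp⟩
  | succ n ih =>
    have hne : (I : Set Q).Nonempty := by
      rw [← Set.ncard_pos (Set.toFinite _)]
      omega
    obtain ⟨m, hm⟩ := (Set.toFinite (I : Set Q)).exists_maximal hne
    obtain ⟨J, hJ⟩ := LowerSet.exists_erase hm
    have hJI : J < I := by
      have : (J : Set Q) ⊂ I := hJ ▸ Set.sdiff_singleton_ssubset.2 hm.1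
      exact this
    obtain ⟨C, hC, hcard, hle⟩ := ih J (by
      rw [hJ, Set.ncard_sdiff_singleton_of_mem hm.1, hI]
      rfl)
    refine ⟨insert I C, ?_, ?_, ?_⟩
    · rw [Finset.coe_insert]
      exact hC.insert fun K hK _ => Or.inr ((hle K hK).trans hJI.le)
    · rw [Finset.card_insert_of_notMem, hcard]
      exact fun h => (hle I h).not_gt hJI
    · intro K hK
      rcases Finset.mem_insert.1 hK with rfl | hK
      · exact le_rfl
      · exact (hle K hK).trans hJI.le

/-- Cardinality is injective on a chain of ideals and takes at most `Nat.card Q + 1` values;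
removing maximal elements one at a time attains this bound. -/
lemma posetRank_lowerSet (Q : Type v) [PartialOrder Q] [Finite Q] :
    posetRank (LowerSet Q) = Nat.card Q := by
  have h : IsGreatest {n : ℕ | ∃ C : Finset (LowerSet Q),
      IsChain (· ≤ ·) (C : Set (LowerSet Q)) ∧ C.card = n} (Nat.card Q + 1) := by
    constructor
    · obtain ⟨C, hC, hcard, -⟩ := exists_chain_le_lowerSet (Nat.card Q) (⊤ : LowerSet Q)
        (by rw [LowerSet.coe_top, Set.ncard_univ])
      exact ⟨C, hC, hcard⟩
    · rintro n ⟨C, hC, rfl⟩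
      rw [← Finset.card_range (Nat.card Q + 1)]
      refine Finset.card_le_card_of_injOn (fun I => (I : Set Q).ncard) ?_ ?_
      · intro I _
        have := Set.ncard_le_card (I : Set Q)
        simpa [Nat.lt_succ_iff] using this
      · intro I hI J hJ hIJ
        rcases hC.total hI hJ with h | h
        · exact SetLike.coe_injective (Set.eq_of_subset_of_ncard_le h hIJ.ge (Set.toFinite _))
        · exact SetLike.coe_injective
            (Set.eq_of_subset_of_ncard_le h hIJ.le (Set.toFinite _)).symm
  rw [posetRank, h.csSup_eq]
  push_cast
  ring

theorem AtMostTwoCovers.finrank_eq {P : Type u} [DistribLattice P] [Finite P] [Nonempty P]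
    (hP : AtMostTwoCovers P) :
    (Module.finrank ℝ (antichainToggleSpace P) : ℤ) = posetRank P + 1 ∧
      (Module.finrank ℝ (idealToggleSpace P) : ℤ) = posetRank P + 1 := by
  classical
  have : Fintype P := Fintype.ofFinite P
  let _ : OrderBot P := Fintype.toOrderBot P
  rw [hP.finrank_antichainToggleSpace, hP.finrank_idealToggleSpace, card_compl_hasTwoLowerCovers,
    posetRank_congr (OrderIso.lowerSetSupIrred (α := P)), posetRank_lowerSet]
  simp

end Rank

/-! ### Monotone paths in a lattice -/

section Confluence

open Relation

variable {L : Type u} [Lattice L] {r : L → L → Prop}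

lemma le_of_reflTransGen (hr : ∀ a b, r a b → a ≤ b) {a b : L} (h : ReflTransGen r a b) :
    a ≤ b := by
  induction h with
  | refl => exact le_rfl
  | tail _ h ih => exact ih.trans (hr _ _ h)

/-- One strip of squares: the step from `b` is pushed down the path from `a`, one completion at a
time. If a square collapses, `a` is already below `b`. -/
lemma reflTransGen_inf_of_step (hr : ∀ a b, r a b → a ≤ b)
    (hloc : ∀ a b c, r a c → r b c → ReflGen r (a ⊓ b) a ∧ ReflGen r (a ⊓ b) b) {a b c : L}
    (hac : ReflTransGen r a c) (hbc : r b c) :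
    ReflGen r (a ⊓ b) a ∧ ReflTransGen r (a ⊓ b) b := by
  induction hac generalizing b with
  | refl =>
    rw [inf_eq_right.2 (hr _ _ hbc)]
    exact ⟨ReflGen.single hbc, ReflTransGen.refl⟩
  | @tail c' c hac' hc' ih =>
    have hle := le_of_reflTransGen hr hac'
    obtain ⟨h1, h2⟩ := hloc c' b c hc' hbc
    rcases (reflGen_iff r _ _).1 h1 with h | h
    · have hcb : c' ≤ b := h.symm ▸ inf_le_right
      rw [inf_eq_left.2 (hle.trans hcb)]
      rw [← h] at h2
      exact ⟨ReflGen.refl, hac'.trans h2.to_reflTransGen⟩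
    · obtain ⟨h3, h4⟩ := ih h
      have he : a ⊓ (c' ⊓ b) = a ⊓ b := by rw [← inf_assoc, inf_eq_left.2 hle]
      rw [he] at h3 h4
      exact ⟨h3, h4.trans h2.to_reflTransGen⟩

lemma reflTransGen_inf (hr : ∀ a b, r a b → a ≤ b)
    (hloc : ∀ a b c, r a c → r b c → ReflGen r (a ⊓ b) a ∧ ReflGen r (a ⊓ b) b) {a b c : L}
    (hac : ReflTransGen r a c) (hbc : ReflTransGen r b c) :
    ReflTransGen r (a ⊓ b) a ∧ ReflTransGen r (a ⊓ b) b := by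
  induction hbc generalizing a with
  | refl =>
    rw [inf_eq_left.2 (le_of_reflTransGen hr hac)]
    exact ⟨ReflTransGen.refl, hac⟩
  | @tail b' c hbb' hb' ih =>
    obtain ⟨h1, h2⟩ := reflTransGen_inf_of_step hr hloc hac hb'
    obtain ⟨h3, h4⟩ := ih h2
    have he : a ⊓ b' ⊓ b = a ⊓ b := by
      rw [inf_assoc, inf_eq_right.2 (le_of_reflTransGen hr hbb')]
    rw [he] at h3 h4
    exact ⟨h3.trans h1.to_reflTransGen, h4⟩

lemma reflTransGen_sup (hr : ∀ a b, r a b → a ≤ b)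
    (hloc : ∀ a b c, r c a → r c b → ReflGen r a (a ⊔ b) ∧ ReflGen r b (a ⊔ b)) {a b c : L}
    (hac : ReflTransGen r c a) (hbc : ReflTransGen r c b) :
    ReflTransGen r a (a ⊔ b) ∧ ReflTransGen r b (a ⊔ b) := by
  have hg : ∀ x y : L, ReflGen r x y → ReflGen (Function.swap r) y x := by
    intro x y h
    rcases (reflGen_iff r _ _).1 h with h | h
    · exact h ▸ ReflGen.refl
    · exact ReflGen.single h
  have := reflTransGen_inf (L := Lᵒᵈ) (r := Function.swap r) (fun a b h => hr b a h)
    (fun a b c h1 h2 => ⟨hg _ _ (hloc a b c h1 h2).1, hg _ _ (hloc a b c h1 h2).2⟩)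
    (a := a) (b := b) (c := c) (reflTransGen_swap.2 hac) (reflTransGen_swap.2 hbc)
  exact ⟨reflTransGen_swap.1 this.1, reflTransGen_swap.1 this.2⟩

/-- If any two steps up from, or down to, the same element can be completed to a square, then two
elements joined by a path up and down have a join and a meet that they are joined to by monotone
paths. -/
lemma reflTransGen_inf_sup (hr : ∀ a b, r a b → a ≤ b)
    (hinf : ∀ a b c, r a c → r b c → ReflGen r (a ⊓ b) a ∧ ReflGen r (a ⊓ b) b)
    (hsup : ∀ a b c, r c a → r c b → ReflGen r a (a ⊔ b) ∧ ReflGen r b (a ⊔ b)) {x y : L}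
    (h : ReflTransGen (fun a b => r a b ∨ r b a) x y) :
    (ReflTransGen r (x ⊓ y) x ∧ ReflTransGen r (x ⊓ y) y) ∧
      (ReflTransGen r x (x ⊔ y) ∧ ReflTransGen r y (x ⊔ y)) := by
  induction h with
  | refl => simp [ReflTransGen.refl]
  | @tail y z _ hyz ih =>
    rcases hyz with hyz | hyz
    -- Extend to the join first; `x` and `z` then have monotone paths to a common target, from which
    -- the meet is obtained.
    · obtain ⟨h1, h2⟩ := reflTransGen_sup hr hsup ih.2.2 (ReflTransGen.single hyz)
      have he : x ⊔ y ⊔ z = x ⊔ z := by rw [sup_assoc, sup_eq_right.2 (hr _ _ hyz)]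
      rw [he] at h1 h2
      exact ⟨reflTransGen_inf hr hinf (ih.2.1.trans h1) h2, ih.2.1.trans h1, h2⟩
    · obtain ⟨h1, h2⟩ := reflTransGen_inf hr hinf ih.1.2 (ReflTransGen.single hyz)
      have he : x ⊓ y ⊓ z = x ⊓ z := by rw [inf_assoc, inf_eq_right.2 (hr _ _ hyz)]
      rw [he] at h1 h2
      exact ⟨⟨h1.trans ih.1.1, h2⟩, reflTransGen_sup hr hsup (h1.trans ih.1.1) h2⟩

end Confluence

/-! ### Diagrams without outward corners are sublattices of the quadrant -/

namespace Diagram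

/-- A unit step to the south or to the east inside `D`. -/
def Step (D : Finset (ℕ × ℕ)) (a b : ℕ × ℕ) : Prop :=
  a ∈ D ∧ b ∈ D ∧ ((b.1 = a.1 + 1 ∧ b.2 = a.2) ∨ (b.1 = a.1 ∧ b.2 = a.2 + 1))

variable {D : Finset (ℕ × ℕ)}

lemma Step.le {a b : ℕ × ℕ} (h : Step D a b) : a ≤ b := by
  obtain ⟨-, -, h⟩ := h
  rw [Prod.le_def]
  omega

/-- Otherwise the lattice point at the bottom right of `(i, j)` is an outward corner associated to
`(i + 1, j + 1)`. -/
lemma NoOutwardCorners.mem_of_right_below (h : NoOutwardCorners D) {i j : ℕ}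
    (h1 : (i + 1, j) ∈ D) (h2 : (i, j + 1) ∈ D) (h3 : (i + 1, j + 1) ∈ D) : (i, j) ∈ D := by
  by_contra h4
  exact h _ h3 i j (Or.inl ⟨⟨Or.inr ⟨h1, h4⟩, Or.inr ⟨h2, h4⟩⟩, by simp, by simp⟩)

lemma NoOutwardCorners.mem_of_left_above (h : NoOutwardCorners D) {i j : ℕ}
    (h1 : (i + 1, j) ∈ D) (h2 : (i, j + 1) ∈ D) (h3 : (i, j) ∈ D) : (i + 1, j + 1) ∈ D := by
  by_contra h4
  exact h _ h3 i j (Or.inr ⟨⟨Or.inl ⟨h1, h4⟩, Or.inl ⟨h2, h4⟩⟩, by simp, by simp⟩)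

lemma NoOutwardCorners.step_inf (h : NoOutwardCorners D) (a b c : ℕ × ℕ) (hac : Step D a c)
    (hbc : Step D b c) :
    Relation.ReflGen (Step D) (a ⊓ b) a ∧ Relation.ReflGen (Step D) (a ⊓ b) b := by
  have key : ∀ i j : ℕ, (i + 1, j) ∈ D → (i, j + 1) ∈ D → (i + 1, j + 1) ∈ D →
      Step D (i, j) (i + 1, j) ∧ Step D (i, j) (i, j + 1) := fun i j h1 h2 h3 =>
    have h4 := h.mem_of_right_below h1 h2 h3
    ⟨⟨h4, h1, by simp⟩, ⟨h4, h2, by simp⟩⟩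
  obtain ⟨a1, a2⟩ := a
  obtain ⟨b1, b2⟩ := b
  obtain ⟨c1, c2⟩ := c
  obtain ⟨ha, hc, hac⟩ := hac
  obtain ⟨hb, -, hbc⟩ := hbc
  rcases hac with ⟨e1, e2⟩ | ⟨e1, e2⟩ <;> rcases hbc with ⟨e3, e4⟩ | ⟨e3, e4⟩ <;>
    simp only at e1 e2 e3 e4
  · obtain rfl : a1 = b1 := by omega
    obtain rfl : a2 = b2 := by omega
    simp [Relation.ReflGen.refl]
  · subst e3 e4
    subst e1 e2
    obtain ⟨h1, h2⟩ := key _ _ hb ha hc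
    have he : ((a1, b2 + 1) : ℕ × ℕ) ⊓ (a1 + 1, b2) = (a1, b2) := by
      simp
    rw [he]
    exact ⟨Relation.ReflGen.single h2, Relation.ReflGen.single h1⟩
  · subst e3 e4
    subst e1 e2
    obtain ⟨h1, h2⟩ := key _ _ ha hb hc
    have he : ((b1 + 1, a2) : ℕ × ℕ) ⊓ (b1, a2 + 1) = (b1, a2) := by
      simp
    rw [he]
    exact ⟨Relation.ReflGen.single h1, Relation.ReflGen.single h2⟩
  · obtain rfl : a1 = b1 := by omega
    obtain rfl : a2 = b2 := by omega
    simp [Relation.ReflGen.refl]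

lemma NoOutwardCorners.step_sup (h : NoOutwardCorners D) (a b c : ℕ × ℕ) (hac : Step D c a)
    (hbc : Step D c b) :
    Relation.ReflGen (Step D) a (a ⊔ b) ∧ Relation.ReflGen (Step D) b (a ⊔ b) := by
  have key : ∀ i j : ℕ, (i + 1, j) ∈ D → (i, j + 1) ∈ D → (i, j) ∈ D →
      Step D (i + 1, j) (i + 1, j + 1) ∧ Step D (i, j + 1) (i + 1, j + 1) := fun i j h1 h2 h3 =>
    have h4 := h.mem_of_left_above h1 h2 h3
    ⟨⟨h1, h4, by simp⟩, ⟨h2, h4, by simp⟩⟩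
  obtain ⟨a1, a2⟩ := a
  obtain ⟨b1, b2⟩ := b
  obtain ⟨c1, c2⟩ := c
  obtain ⟨hc, ha, hac⟩ := hac
  obtain ⟨-, hb, hbc⟩ := hbc
  rcases hac with ⟨e1, e2⟩ | ⟨e1, e2⟩ <;> rcases hbc with ⟨e3, e4⟩ | ⟨e3, e4⟩ <;>
    simp only at e1 e2 e3 e4 <;> subst a1 a2 b1 b2
  · simp [Relation.ReflGen.refl]
  · obtain ⟨h1, h2⟩ := key _ _ ha hb hc
    have he : ((c1 + 1, c2) : ℕ × ℕ) ⊔ (c1, c2 + 1) = (c1 + 1, c2 + 1) := by simp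
    rw [he]
    exact ⟨Relation.ReflGen.single h1, Relation.ReflGen.single h2⟩
  · obtain ⟨h1, h2⟩ := key _ _ hb ha hc
    have he : ((c1, c2 + 1) : ℕ × ℕ) ⊔ (c1 + 1, c2) = (c1 + 1, c2 + 1) := by simp
    rw [he]
    exact ⟨Relation.ReflGen.single h2, Relation.ReflGen.single h1⟩
  · simp [Relation.ReflGen.refl]

/-- A connected diagram without outward corners is closed under meets and joins in `ℕ × ℕ`. -/
theorem inf_mem_and_sup_mem (hconn : IsConnected D) (h : NoOutwardCorners D) {x y : ℕ × ℕ}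
    (hx : x ∈ D) (hy : y ∈ D) : x ⊓ y ∈ D ∧ x ⊔ y ∈ D := by
  have hpath : Relation.ReflTransGen (fun a b => Step D a b ∨ Step D b a) x y := by
    refine (hconn x hx y hy).lift id fun a b hab => ?_
    obtain ⟨ha, hb, hab⟩ := hab
    rcases hab with ⟨h1, h2 | h2⟩ | ⟨h1, h2 | h2⟩
    · exact Or.inl ⟨ha, hb, Or.inr ⟨h1.symm, h2.symm⟩⟩
    · exact Or.inr ⟨hb, ha, Or.inr ⟨h1, h2.symm⟩⟩
    · exact Or.inl ⟨ha, hb, Or.inl ⟨h2.symm, h1.symm⟩⟩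
    · exact Or.inr ⟨hb, ha, Or.inl ⟨h2.symm, h1⟩⟩
  obtain ⟨⟨h1, -⟩, h2, -⟩ :=
    reflTransGen_inf_sup (fun _ _ => Step.le) h.step_inf h.step_sup hpath
  constructor
  · rcases Relation.ReflTransGen.cases_head h1 with h1 | ⟨_, h1, _⟩
    · rwa [h1]
    · exact h1.1
  · rcases Relation.ReflTransGen.cases_tail h2 with h2 | ⟨_, _, h2⟩
    · rwa [h2]
    · exact h2.2.1

end Diagram

/-! ### Sublattices of the quadrant -/

section Planar

/-- Distinct lower covers join to `x`, so in each coordinate at most one of them falls short of `x`.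
Each falls short somewhere, and there are only two coordinates; upper covers are dual. -/
lemma AtMostTwoCovers.of_injective {P : Type u} [DistribLattice P] (f : LatticeHom P (ℕ × ℕ))
    (hf : Function.Injective f) : AtMostTwoCovers P := by
  constructor
  · intro x u v w hu hv hw
    by_contra! h
    have h1 : f u ⊔ f v = f x := by rw [← map_sup, hu.wcovBy.sup_eq hv.wcovBy h.1]
    have h2 : f v ⊔ f w = f x := by rw [← map_sup, hv.wcovBy.sup_eq hw.wcovBy h.2.1]
    have h3 : f u ⊔ f w = f x := by rw [← map_sup, hu.wcovBy.sup_eq hw.wcovBy h.2.2]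
    have hu' := hf.ne hu.ne
    have hv' := hf.ne hv.ne
    have hw' := hf.ne hw.ne
    simp only [Prod.ext_iff, Prod.fst_sup, Prod.snd_sup, ne_eq] at *
    omega
  · intro x u v w hu hv hw
    by_contra! h
    have h1 : f u ⊓ f v = f x := by rw [← map_inf, hu.wcovBy.inf_eq hv.wcovBy h.1]
    have h2 : f v ⊓ f w = f x := by rw [← map_inf, hv.wcovBy.inf_eq hw.wcovBy h.2.1]
    have h3 : f u ⊓ f w = f x := by rw [← map_inf, hu.wcovBy.inf_eq hw.wcovBy h.2.2]
    have hu' := hf.ne hu.ne'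
    have hv' := hf.ne hv.ne'
    have hw' := hf.ne hw.ne'
    simp only [Prod.ext_iff, Prod.fst_inf, Prod.snd_inf, ne_eq] at *
    omega

/-- Among any three elements of an antichain of `ℕ × ℕ`, one is the join of its meets with the
other two. -/
lemma posetWidth_supIrred_le_two {P : Type u} [DistribLattice P] [Finite P]
    (f : LatticeHom P (ℕ × ℕ)) (hf : Function.Injective f) :
    posetWidth {a : P // SupIrred a} ≤ 2 := by
  -- Here `b` is the middle of a staircase: it takes its second coordinate from `a ⊓ b` and its
  -- first from `b ⊓ c`, both strictly smaller.
  have key : ∀ a b c : P, SupIrred b → (f a).1 < (f b).1 → (f c).2 < (f b).2 →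
      (f b).2 ≤ (f a).2 → (f b).1 ≤ (f c).1 → False := by
    intro a b c hb h1 h2 h3 h4
    have he : (a ⊓ b) ⊔ (b ⊓ c) = b := by
      apply hf
      rw [map_sup, map_inf, map_inf]
      simp only [Prod.ext_iff, Prod.fst_inf, Prod.snd_inf, Prod.fst_sup, Prod.snd_sup]
      omega
    rcases hb.2 he with h | h
    · have := congrArg (fun t => (f t).1) h
      simp only [map_inf, Prod.fst_inf] at this
      omega
    · have := congrArg (fun t => (f t).2) h
      simp only [map_inf, Prod.snd_inf] at this
      omega
  have hle : ∀ a b : P, (f a).1 ≤ (f b).1 → (f a).2 ≤ (f b).2 → a ≤ b := by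
    intro a b h1 h2
    rw [← inf_eq_left]
    apply hf
    rw [map_inf]
    exact inf_eq_left.2 ⟨h1, h2⟩
  refine csSup_le' ?_
  rintro n ⟨A, hA, rfl⟩
  by_contra! hcard
  obtain ⟨a, b, c, ha, hb, hc, hab, hac, hbc⟩ := Finset.two_lt_card_iff.1 hcard
  have hn : ∀ x ∈ A, ∀ y ∈ A, x ≠ y →
      ((f x.1).1 < (f y.1).1 ∧ (f y.1).2 < (f x.1).2) ∨
        ((f y.1).1 < (f x.1).1 ∧ (f x.1).2 < (f y.1).2) := by
    intro x hx y hy hxy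
    have h1 : ¬ x.1 ≤ y.1 := hA hx hy hxy
    have h2 : ¬ y.1 ≤ x.1 := hA hy hx hxy.symm
    have h3 := mt (fun h : _ ∧ _ => hle x.1 y.1 h.1 h.2) h1
    have h4 := mt (fun h : _ ∧ _ => hle y.1 x.1 h.1 h.2) h2
    omega
  have h1 := hn a ha b hb hab
  have h2 := hn a ha c hc hac
  have h3 := hn b hb c hc hbc
  -- Any of the three may be the middle one, with the other two on either side.
  have k1 := key b a c a.2
  have k2 := key c a b a.2
  have k3 := key a b c b.2
  have k4 := key c b a b.2
  have k5 := key a c b c.2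
  have k6 := key b c a c.2
  simp only [imp_false] at k1 k2 k3 k4 k5 k6
  omega

end Planar

/-! ### Posets of width at most two are unions of two chains -/

section Width

variable {Q : Type v} [PartialOrder Q]

lemma exists_antichain_card_of_orderIso {A : Type u} {B : Type v} [PartialOrder A] [PartialOrder B]
    (e : A ≃o B) {n : ℕ} (h : ∃ C : Finset A, IsAntichain (· ≤ ·) (C : Set A) ∧ C.card = n) :
    ∃ C : Finset B, IsAntichain (· ≤ ·) (C : Set B) ∧ C.card = n := by
  obtain ⟨C, hC, rfl⟩ := h
  refine ⟨C.map e.toEquiv.toEmbedding, ?_, Finset.card_map _⟩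
  rw [Finset.coe_map]
  exact hC.image _ fun x y hxy => e.le_iff_le.1 hxy

lemma posetWidth_congr {A : Type u} {B : Type v} [PartialOrder A] [PartialOrder B] (e : A ≃o B) :
    posetWidth A = posetWidth B := by
  rw [posetWidth, posetWidth]
  congr 1
  ext n
  exact ⟨exists_antichain_card_of_orderIso e, exists_antichain_card_of_orderIso e.symm⟩

lemma exists_le_of_posetWidth_le_two [Finite Q] (h : posetWidth Q ≤ 2) (a b c : Q) :
    ¬ (IncompRel (· ≤ ·) a b ∧ IncompRel (· ≤ ·) b c ∧ IncompRel (· ≤ ·) a c) := by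
  classical
  rintro ⟨hab, hbc, hac⟩
  have hne : ∀ {x y : Q}, IncompRel (· ≤ ·) x y → x ≠ y := fun hxy hxy' => hxy.1 hxy'.le
  have hA : IsAntichain (· ≤ ·) ((({a, b, c} : Finset Q)) : Set Q) := by
    intro x hx y hy hxy
    simp only [Finset.coe_insert, Finset.coe_singleton, Set.mem_insert_iff,
      Set.mem_singleton_iff] at hx hy
    rcases hx with rfl | rfl | rfl <;> rcases hy with rfl | rfl | rfl
    exacts [absurd rfl hxy, hab.1, hac.1, hab.2, absurd rfl hxy, hbc.1, hac.2, hbc.2,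
      absurd rfl hxy]
  have hbdd : BddAbove {n : ℕ | ∃ A : Finset Q, IsAntichain (· ≤ ·) (A : Set Q) ∧ A.card = n} := by
    have : Fintype Q := Fintype.ofFinite Q
    refine ⟨Fintype.card Q, ?_⟩
    rintro n ⟨A, -, rfl⟩
    exact A.card_le_univ
  have h3 := le_csSup hbdd ⟨_, hA, Finset.card_eq_three.2 ⟨a, b, c, hne hab, hne hac, hne hbc, rfl⟩⟩
  rw [posetWidth] at h
  omega

/-- Cut `C₁` at `x`: the part below `x` extends by `a`, and the rest is comparable to all of `C₂` by
`hmax`. -/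
lemma exists_isChain_of_le {C₁ C₂ : Set Q} (h₁ : IsChain (· ≤ ·) C₁) (h₂ : IsChain (· ≤ ·) C₂)
    {a x : Q} (hxa : x ≤ a)
    (hmax : ∀ z ∈ C₁, ∀ y ∈ C₂, IncompRel (· ≤ ·) z y → z ≤ x) :
    ∃ K R : Set Q, IsChain (· ≤ ·) K ∧ IsChain (· ≤ ·) R ∧ insert a (C₁ ∪ C₂) ⊆ K ∪ R := by
  refine ⟨insert a {z ∈ C₁ | z ≤ x}, {z ∈ C₁ | ¬ z ≤ x} ∪ C₂, ?_, ?_, ?_⟩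
  · exact (h₁.mono fun z hz => hz.1).insert fun z hz _ => Or.inr (hz.2.trans hxa)
  · refine (isChain_union).2 ⟨h₁.mono fun z hz => hz.1, h₂, ?_⟩
    intro z hz y hy _
    by_contra h
    push Not at h
    exact hz.2 (hmax z hz.1 y hy h)
  · rintro z (rfl | hz | hz)
    · exact Or.inl (Set.mem_insert _ _)
    · by_cases hzx : z ≤ x
      · exact Or.inl (Or.inr ⟨hz, hzx⟩)
      · exact Or.inr (Or.inl ⟨hz, hzx⟩)
    · exact Or.inr (Or.inr hz)

/-- Dilworth's theorem for width two. -/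
lemma exists_isChain_union_of_forall_not_incompRel
    (h : ∀ a b c : Q, ¬ (IncompRel (· ≤ ·) a b ∧ IncompRel (· ≤ ·) b c ∧ IncompRel (· ≤ ·) a c))
    (n : ℕ) (S : Finset Q) (hS : S.card = n) :
    ∃ C₁ C₂ : Set Q, IsChain (· ≤ ·) C₁ ∧ IsChain (· ≤ ·) C₂ ∧ (S : Set Q) ⊆ C₁ ∪ C₂ := by
  classical
  induction n generalizing S with
  | zero =>
    refine ⟨∅, ∅, IsChain.empty, IsChain.empty, ?_⟩
    simp [Finset.card_eq_zero.1 hS]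
  | succ n ih =>
    obtain ⟨a, haS, hamax⟩ := S.exists_maximal (Finset.card_pos.1 (by omega))
    obtain ⟨B₁, B₂, hB₁, hB₂, hsub⟩ := ih (S.erase a) (by rw [Finset.card_erase_of_mem haS]; omega)
    obtain ⟨C₁, C₂, h₁, h₂, hC⟩ : ∃ C₁ C₂ : Set Q, IsChain (· ≤ ·) C₁ ∧ IsChain (· ≤ ·) C₂ ∧
        ((S.erase a : Finset Q) : Set Q) = C₁ ∪ C₂ := by
      refine ⟨B₁ ∩ (S.erase a : Finset Q), B₂ ∩ (S.erase a : Finset Q),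
        hB₁.mono Set.inter_subset_left, hB₂.mono Set.inter_subset_left, ?_⟩
      rw [← Set.union_inter_distrib_right, Set.inter_eq_right.2 hsub]
    have hSC : (S : Set Q) = insert a (C₁ ∪ C₂) := by
      rw [← hC, ← Finset.coe_insert, Finset.insert_erase haS]
    have hna : ∀ z ∈ C₁ ∪ C₂, ¬ a ≤ z := by
      intro z hz haz
      rw [← hC, Finset.mem_coe, Finset.mem_erase] at hz
      exact hz.1 (le_antisymm (hamax hz.2 haz) haz)
    have hfin₁ : C₁.Finite := (S.erase a).finite_toSet.subset (hC ▸ Set.subset_union_left)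
    have hfin₂ : C₂.Finite := (S.erase a).finite_toSet.subset (hC ▸ Set.subset_union_right)
    rw [hSC]
    by_cases hex : ∃ x ∈ C₁, ∃ y ∈ C₂, IncompRel (· ≤ ·) x y
    · obtain ⟨x, hx, y, hy, hxy⟩ := hex
      -- The largest elements of each chain that are incomparable to something in the other. They
      -- are incomparable to each other, so `a`, which lies below neither, must lie above one of
      -- them.
      obtain ⟨x₁, ⟨hx₁, y₁, hy₁, hxy₁⟩, hmax₁⟩ :=
        (hfin₁.subset (Set.sep_subset C₁ fun x => ∃ y ∈ C₂, IncompRel (· ≤ ·) x y)).exists_maximal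
          ⟨x, hx, y, hy, hxy⟩
      obtain ⟨x₂, ⟨hx₂, y₂, hy₂, hxy₂⟩, hmax₂⟩ :=
        (hfin₂.subset (Set.sep_subset C₂ fun y => ∃ x ∈ C₁, IncompRel (· ≤ ·) y x)).exists_maximal
          ⟨y, hy, x, hx, hxy.symm⟩
      have hle₁ : ∀ z ∈ C₁, ∀ y ∈ C₂, IncompRel (· ≤ ·) z y → z ≤ x₁ := fun z hz y hy hzy =>
        (h₁.total hz hx₁).elim id fun h' => hmax₁ ⟨hz, y, hy, hzy⟩ h'
      have hle₂ : ∀ z ∈ C₂, ∀ y ∈ C₁, IncompRel (· ≤ ·) z y → z ≤ x₂ := fun z hz y hy hzy =>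
        (h₂.total hz hx₂).elim id fun h' => hmax₂ ⟨hz, y, hy, hzy⟩ h'
      have hinc : IncompRel (· ≤ ·) x₁ x₂ :=
        ⟨fun h' => hxy₂.2 ((hle₁ y₂ hy₂ x₂ hx₂ hxy₂.symm).trans h'),
          fun h' => hxy₁.2 ((hle₂ y₁ hy₁ x₁ hx₁ hxy₁.symm).trans h')⟩
      by_cases ha₁ : x₁ ≤ a
      · exact exists_isChain_of_le h₁ h₂ ha₁ hle₁
      · have ha₂ : x₂ ≤ a := by
          by_contra ha₂
          exact h x₁ x₂ a ⟨hinc, ⟨ha₂, hna _ (Or.inr hx₂)⟩, ⟨ha₁, hna _ (Or.inl hx₁)⟩⟩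
        rw [Set.union_comm]
        exact exists_isChain_of_le h₂ h₁ ha₂ hle₂
    · refine ⟨{a}, C₁ ∪ C₂, by simp, isChain_union.2 ⟨h₁, h₂, ?_⟩, by rw [Set.insert_eq]⟩
      intro x hx y hy _
      by_contra hxy
      push Not at hxy
      exact hex ⟨x, hx, y, hy, hxy⟩

lemma exists_isChain_compl [Finite Q] (h : posetWidth Q ≤ 2) :
    ∃ C : Set Q, IsChain (· ≤ ·) C ∧ IsChain (· ≤ ·) Cᶜ := by
  have : Fintype Q := Fintype.ofFinite Q
  obtain ⟨C₁, C₂, h₁, h₂, hC⟩ := exists_isChain_union_of_forall_not_incompRel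
    (exists_le_of_posetWidth_le_two h) _ (Finset.univ : Finset Q) rfl
  refine ⟨C₁, h₁, h₂.mono fun x hx => ?_⟩
  have : x ∈ C₁ ∪ C₂ := hC (Finset.mem_coe.2 (Finset.mem_univ x))
  exact this.resolve_left hx

end Width

/-! ### The diagram of the order ideals of a union of two chains -/

section ChainCoordinates

variable {Q : Type v} [PartialOrder Q]

/-- Traces of ideals on a chain are initial segments. Their cardinalities hence turn meets and joins
into minima and maxima. -/
lemma IsChain.inter_lowerSet_subset_total {C : Set Q} (hC : IsChain (· ≤ ·) C) (I J : LowerSet Q) :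
    (I : Set Q) ∩ C ⊆ (J : Set Q) ∩ C ∨ (J : Set Q) ∩ C ⊆ (I : Set Q) ∩ C := by
  by_contra! h
  obtain ⟨h1, h2⟩ := h
  obtain ⟨x, hx, hx'⟩ := Set.not_subset.1 h1
  obtain ⟨y, hy, hy'⟩ := Set.not_subset.1 h2
  rcases hC.total hx.2 hy.2 with h | h
  · exact hx' ⟨J.lower h hy.1, hx.2⟩
  · exact hy' ⟨I.lower h hx.1, hy.2⟩

variable [Finite Q]

lemma IsChain.ncard_inf_inter {C : Set Q} (hC : IsChain (· ≤ ·) C) (I J : LowerSet Q) :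
    (((I ⊓ J : LowerSet Q) : Set Q) ∩ C).ncard =
      ((I : Set Q) ∩ C).ncard ⊓ ((J : Set Q) ∩ C).ncard := by
  rw [LowerSet.coe_inf, Set.inter_inter_distrib_right]
  rcases hC.inter_lowerSet_subset_total I J with h | h
  · rw [Set.inter_eq_left.2 h, inf_eq_left.2 (Set.ncard_le_ncard h)]
  · rw [Set.inter_eq_right.2 h, inf_eq_right.2 (Set.ncard_le_ncard h)]

lemma IsChain.ncard_sup_inter {C : Set Q} (hC : IsChain (· ≤ ·) C) (I J : LowerSet Q) :
    (((I ⊔ J : LowerSet Q) : Set Q) ∩ C).ncard =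
      ((I : Set Q) ∩ C).ncard ⊔ ((J : Set Q) ∩ C).ncard := by
  rw [LowerSet.coe_sup, Set.union_inter_distrib_right]
  rcases hC.inter_lowerSet_subset_total I J with h | h
  · rw [Set.union_eq_right.2 h, sup_eq_right.2 (Set.ncard_le_ncard h)]
  · rw [Set.union_eq_left.2 h, sup_eq_left.2 (Set.ncard_le_ncard h)]

/-- The coordinates of an order ideal: its numbers of elements in a chain and in the complementary
chain. -/
def chainCoordinates {C : Set Q} (hC : IsChain (· ≤ ·) C) (hC' : IsChain (· ≤ ·) Cᶜ) :
    LatticeHom (LowerSet Q) (ℕ × ℕ) where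
  toFun I := (((I : Set Q) ∩ C).ncard, ((I : Set Q) ∩ Cᶜ).ncard)
  map_sup' I J := Prod.ext (hC.ncard_sup_inter I J) (hC'.ncard_sup_inter I J)
  map_inf' I J := Prod.ext (hC.ncard_inf_inter I J) (hC'.ncard_inf_inter I J)

variable {C : Set Q} (hC : IsChain (· ≤ ·) C) (hC' : IsChain (· ≤ ·) Cᶜ)

lemma chainCoordinates_apply (I : LowerSet Q) :
    chainCoordinates hC hC' I = (((I : Set Q) ∩ C).ncard, ((I : Set Q) ∩ Cᶜ).ncard) :=
  rfl

lemma IsChain.inter_eq_of_ncard_eq {C : Set Q} (hC : IsChain (· ≤ ·) C) {I J : LowerSet Q}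
    (h : ((I : Set Q) ∩ C).ncard = ((J : Set Q) ∩ C).ncard) :
    (I : Set Q) ∩ C = (J : Set Q) ∩ C := by
  rcases hC.inter_lowerSet_subset_total I J with h' | h'
  · exact Set.eq_of_subset_of_ncard_le h' h.ge
  · exact (Set.eq_of_subset_of_ncard_le h' h.le).symm

lemma chainCoordinates_injective : Function.Injective (chainCoordinates hC hC') := by
  intro I J h
  rw [chainCoordinates_apply, chainCoordinates_apply, Prod.mk.injEq] at h
  apply SetLike.coe_injective
  rw [← Set.inter_union_compl (I : Set Q) C, ← Set.inter_union_compl (J : Set Q) C,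
    hC.inter_eq_of_ncard_eq h.1, hC'.inter_eq_of_ncard_eq h.2]

lemma chainCoordinates_le_iff {I J : LowerSet Q} :
    chainCoordinates hC hC' I ≤ chainCoordinates hC hC' J ↔ I ≤ J := by
  rw [← inf_eq_left, ← map_inf, (chainCoordinates_injective hC hC').eq_iff, inf_eq_left]

/-- The new element lies in exactly one of the two complementary chains, so the cell moves one unit
south or east. -/
lemma chainCoordinates_insert {I J : LowerSet Q} {m : Q} (hm : m ∉ I)
    (hJ : (J : Set Q) = insert m (I : Set Q)) :
    chainCoordinates hC hC' J =
        ((chainCoordinates hC hC' I).1 + 1, (chainCoordinates hC hC' I).2) ∨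
      chainCoordinates hC hC' J =
        ((chainCoordinates hC hC' I).1, (chainCoordinates hC hC' I).2 + 1) := by
  have hm' : ∀ A : Set Q, m ∉ (I : Set Q) ∩ A := fun A h => hm h.1
  simp only [chainCoordinates_apply, hJ]
  by_cases h : m ∈ C
  · left
    rw [Set.insert_inter_of_mem h, Set.insert_inter_of_notMem (Set.notMem_compl_iff.2 h),
      Set.ncard_insert_of_notMem (hm' C)]
  · right
    rw [Set.insert_inter_of_notMem h, Set.insert_inter_of_mem (show m ∈ Cᶜ from h),
      Set.ncard_insert_of_notMem (hm' Cᶜ)]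

lemma exists_insert_of_lt {I J : LowerSet Q} (h : I < J) :
    ∃ (K : LowerSet Q) (m : Q), m ∉ I ∧ (K : Set Q) = insert m (I : Set Q) := by
  obtain ⟨m, hm⟩ := (Set.toFinite ((I : Set Q)ᶜ)).exists_minimal (by
    obtain ⟨x, -, hx⟩ := Set.exists_of_ssubset (show (I : Set Q) ⊂ J from h)
    exact ⟨x, hx⟩)
  exact ⟨⟨_, ((notMem_and_isLowerSet_insert_iff m I).2 hm).2⟩, m, hm.1, rfl⟩

lemma exists_erase_of_lt {I J : LowerSet Q} (h : I < J) :
    ∃ (K : LowerSet Q) (m : Q), m ∉ K ∧ (J : Set Q) = insert m (K : Set Q) := by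
  obtain ⟨m, hm⟩ := (Set.toFinite (J : Set Q)).exists_maximal (by
    obtain ⟨x, hx, -⟩ := Set.exists_of_ssubset (show (I : Set Q) ⊂ J from h)
    exact ⟨x, hx⟩)
  obtain ⟨K, hK⟩ := LowerSet.exists_erase hm
  refine ⟨K, m, ?_, ?_⟩
  · rw [← SetLike.mem_coe, hK]
    exact fun h => h.2 rfl
  · rw [hK]
    exact (Set.insert_sdiff_self_of_mem hm.1).symm

/-- The diagram of the order ideals of a union of two chains. -/
def idealDiagram : Finset (ℕ × ℕ) :=
  (Set.finite_range (chainCoordinates hC hC')).toFinset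

lemma mem_idealDiagram {x : ℕ × ℕ} :
    x ∈ idealDiagram hC hC' ↔ ∃ I, chainCoordinates hC hC' I = x := by
  simp [idealDiagram]

lemma defines_idealDiagram : Diagram.Defines (idealDiagram hC hC') (LowerSet Q) := by
  refine ⟨⟨Equiv.ofBijective
    (fun I => ⟨chainCoordinates hC hC' I, (mem_idealDiagram hC hC').2 ⟨I, rfl⟩⟩) ⟨?_, ?_⟩, ?_⟩⟩
  · exact fun I J h => chainCoordinates_injective hC hC' (congrArg Subtype.val h)
  · rintro ⟨x, hx⟩
    obtain ⟨I, rfl⟩ := (mem_idealDiagram hC hC').1 hx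
    exact ⟨I, rfl⟩
  · exact chainCoordinates_le_iff hC hC'

/-- Removing maximal elements one at a time joins every cell to that of the empty ideal. -/
lemma isConnected_idealDiagram : Diagram.IsConnected (idealDiagram hC hC') := by
  set D := idealDiagram hC hC' with hD
  have hmem : ∀ I, chainCoordinates hC hC' I ∈ D := fun I => (mem_idealDiagram hC hC').2 ⟨I, rfl⟩
  have hbot : ∀ I : LowerSet Q, Relation.ReflTransGen
      (fun a b => a ∈ D ∧ b ∈ D ∧ Diagram.EdgeAdj a b)
      (chainCoordinates hC hC' ⊥) (chainCoordinates hC hC' I) := by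
    intro I
    induction I using WellFoundedLT.induction with
    | ind I ih =>
      rcases eq_or_ne I ⊥ with rfl | hI
      · exact Relation.ReflTransGen.refl
      · obtain ⟨K, m, hm, hK⟩ := exists_erase_of_lt (bot_lt_iff_ne_bot.2 hI)
        have hKI : K < I := by
          have : (K : Set Q) ⊂ I := hK ▸ Set.ssubset_insert hm
          exact this
        refine (ih K hKI).tail ⟨hmem K, hmem I, ?_⟩
        rcases chainCoordinates_insert hC hC' hm hK with h | h <;> rw [h]
        · exact Or.inr ⟨rfl, Or.inl rfl⟩
        · exact Or.inl ⟨rfl, Or.inl rfl⟩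
  have hsymm : Std.Symm (fun a b => a ∈ D ∧ b ∈ D ∧ Diagram.EdgeAdj a b) := by
    refine ⟨?_⟩
    rintro a b ⟨ha, hb, h⟩
    refine ⟨hb, ha, ?_⟩
    unfold Diagram.EdgeAdj at h ⊢
    omega
  intro x hx y hy
  obtain ⟨I, rfl⟩ := (mem_idealDiagram hC hC').1 hx
  obtain ⟨J, rfl⟩ := (mem_idealDiagram hC hC').1 hy
  exact (Relation.ReflTransGen.stdSymm.symm _ _ (hbot I)).trans (hbot J)

lemma inf_mem_idealDiagram {x y : ℕ × ℕ} (hx : x ∈ idealDiagram hC hC')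
    (hy : y ∈ idealDiagram hC hC') : x ⊓ y ∈ idealDiagram hC hC' := by
  obtain ⟨I, rfl⟩ := (mem_idealDiagram hC hC').1 hx
  obtain ⟨J, rfl⟩ := (mem_idealDiagram hC hC').1 hy
  exact (mem_idealDiagram hC hC').2 ⟨I ⊓ J, map_inf _ _ _⟩

lemma sup_mem_idealDiagram {x y : ℕ × ℕ} (hx : x ∈ idealDiagram hC hC')
    (hy : y ∈ idealDiagram hC hC') : x ⊔ y ∈ idealDiagram hC hC' := by
  obtain ⟨I, rfl⟩ := (mem_idealDiagram hC hC').1 hx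
  obtain ⟨J, rfl⟩ := (mem_idealDiagram hC hC').1 hy
  exact (mem_idealDiagram hC hC').2 ⟨I ⊔ J, map_sup _ _ _⟩

/-- A hole would be the join of its north and west neighbours. -/
lemma noHoles_idealDiagram : Diagram.NoHoles (idealDiagram hC hC') := by
  rintro ⟨i, j, h1, -, h3, -, h5⟩
  have := sup_mem_idealDiagram hC hC' h1 h3
  simp at this
  exact h5 this

/-- At a northwest corner, a missing position would be the meet of its south and east neighbours. If
it is a cell, its ideal is not everything, and adding an element puts one of these neighbours in the
diagram. Southeast corners are dual. -/
lemma noOutwardCorners_idealDiagram : Diagram.NoOutwardCorners (idealDiagram hC hC') := by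
  rintro x hx r c (⟨⟨h1, h2⟩, hr, hc⟩ | ⟨⟨h1, h2⟩, hr, hc⟩)
  · rcases h1 with ⟨ha, hb⟩ | ⟨ha, hb⟩ <;> rcases h2 with ⟨ha', hb'⟩ | ⟨ha', hb'⟩
    · obtain ⟨I, hI⟩ := (mem_idealDiagram hC hC').1 ha
      obtain ⟨J, rfl⟩ := (mem_idealDiagram hC hC').1 hx
      have hIJ : I < J := by
        refine lt_of_le_of_ne ?_ ?_
        · rw [← chainCoordinates_le_iff hC hC', hI]
          exact ⟨hr.le, hc.le⟩
        · rintro rfl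
          rw [hI] at hr
          exact lt_irrefl _ hr
      obtain ⟨K, m, hm, hK⟩ := exists_insert_of_lt hIJ
      rcases chainCoordinates_insert hC hC' hm hK with h | h <;> rw [hI] at h
      · exact hb ((mem_idealDiagram hC hC').2 ⟨K, h⟩)
      · exact hb' ((mem_idealDiagram hC hC').2 ⟨K, h⟩)
    · exact hb' ha
    · exact hb ha'
    · have := inf_mem_idealDiagram hC hC' ha ha'
      simp at this
      exact hb this
  · rcases h1 with ⟨ha, hb⟩ | ⟨ha, hb⟩ <;> rcases h2 with ⟨ha', hb'⟩ | ⟨ha', hb'⟩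
    · have := sup_mem_idealDiagram hC hC' ha ha'
      simp at this
      exact hb this
    · exact hb ha'
    · exact hb' ha
    · obtain ⟨J, hJ⟩ := (mem_idealDiagram hC hC').1 ha
      obtain ⟨I, rfl⟩ := (mem_idealDiagram hC hC').1 hx
      have hIJ : I < J := by
        refine lt_of_le_of_ne ?_ ?_
        · rw [← chainCoordinates_le_iff hC hC', hJ]
          exact ⟨hr.trans (Nat.le_succ _), hc.trans (Nat.le_succ _)⟩
        · rintro rfl
          rw [hJ] at hr
          exact absurd hr (by simp)
      obtain ⟨K, m, hm, hK⟩ := exists_erase_of_lt hIJ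
      rcases chainCoordinates_insert hC hC' hm hK with h | h <;>
        rw [hJ, Prod.mk.injEq, Nat.add_right_cancel_iff] at h
      · exact hb' ((mem_idealDiagram hC hC').2 ⟨K, Prod.ext h.1.symm h.2.symm⟩)
      · exact hb ((mem_idealDiagram hC hC').2 ⟨K, Prod.ext h.1.symm h.2.symm⟩)

end ChainCoordinates

/-! ### Conclusion -/

/-- The lattice structure on a poset that is isomorphic to a distributive lattice. -/
abbrev DistribLattice.ofOrderIso {P : Type u} {L : Type v} [PartialOrder P] [DistribLattice L]
    (e : P ≃o L) : DistribLattice P where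
  sup a b := e.symm (e a ⊔ e b)
  inf a b := e.symm (e a ⊓ e b)
  le_sup_left a b := by simp [OrderIso.le_symm_apply]
  le_sup_right a b := by simp [OrderIso.le_symm_apply]
  sup_le a b c h1 h2 := by simp [OrderIso.symm_apply_le, h1, h2]
  inf_le_left a b := by simp [OrderIso.symm_apply_le]
  inf_le_right a b := by simp [OrderIso.symm_apply_le]
  le_inf a b c h1 h2 := by simp [OrderIso.le_symm_apply, h1, h2]
  le_sup_inf a b c := by
    change e.symm (e (e.symm (e a ⊔ e b)) ⊓ e (e.symm (e a ⊔ e c))) ≤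
      e.symm (e a ⊔ e (e.symm (e b ⊓ e c)))
    simp [sup_inf_left]

namespace Diagram

theorem finrank_eq_of_defines {P : Type u} [PartialOrder P] [Finite P] {D : Finset (ℕ × ℕ)}
    (hconn : IsConnected D) (hD : NoOutwardCorners D) (h : Defines D P) :
    (Module.finrank ℝ (antichainToggleSpace P) : ℤ) = posetRank P + 1 ∧
      (Module.finrank ℝ (idealToggleSpace P) : ℤ) = posetRank P + 1 := by
  rcases isEmpty_or_nonempty P with hP | hP
  -- The empty poset has only the empty chain, so its integer rank is `-1`, matching two zero
  -- spaces.
  · have hrank : posetRank P = -1 := by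
      have : {n : ℕ | ∃ C : Finset P, IsChain (· ≤ ·) (C : Set P) ∧ C.card = n} = {0} := by
        ext n
        constructor
        · rintro ⟨C, -, rfl⟩
          simp [Finset.eq_empty_of_isEmpty C]
        · rintro rfl
          exact ⟨∅, by simp, rfl⟩
      rw [posetRank, this, csSup_singleton]
      rfl
    rw [antichainToggleSpace_eq, idealToggleSpace_eq, hrank]
    simp [Set.range_eq_empty]
  · obtain ⟨e⟩ := h
    let _ : DistribLattice {x // x ∈ D} := Subtype.distribLattice
      (fun _ _ hx hy => (inf_mem_and_sup_mem hconn hD hx hy).2)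
      (fun _ _ hx hy => (inf_mem_and_sup_mem hconn hD hx hy).1)
    let inst : DistribLattice P := DistribLattice.ofOrderIso e
    let f : LatticeHom P (ℕ × ℕ) :=
      { toFun := fun p => (e p : ℕ × ℕ)
        map_sup' := fun a b => congrArg Subtype.val (e.apply_symm_apply (e a ⊔ e b))
        map_inf' := fun a b => congrArg Subtype.val (e.apply_symm_apply (e a ⊓ e b)) }
    exact (AtMostTwoCovers.of_injective f (Subtype.val_injective.comp e.injective)).finrank_eq

theorem exists_lowerSet_of_defines {P : Type u} [PartialOrder P] [Nonempty P]
    {D : Finset (ℕ × ℕ)} (hconn : IsConnected D) (hD : NoOutwardCorners D) (h : Defines D P) :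
    ∃ (Q : Type v) (_ : PartialOrder Q), Finite Q ∧ posetWidth Q ≤ 2 ∧
      Nonempty (P ≃o LowerSet Q) := by
  classical
  obtain ⟨e⟩ := h
  let _ : DistribLattice {x // x ∈ D} := Subtype.distribLattice
    (fun _ _ hx hy => (inf_mem_and_sup_mem hconn hD hx hy).2)
    (fun _ _ hx hy => (inf_mem_and_sup_mem hconn hD hx hy).1)
  have : Nonempty {x // x ∈ D} := ⟨e (Classical.arbitrary P)⟩
  let _ : OrderBot {x // x ∈ D} := Fintype.toOrderBot _
  let f : LatticeHom {x // x ∈ D} (ℕ × ℕ) :=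
    { toFun := Subtype.val
      map_sup' := fun _ _ => rfl
      map_inf' := fun _ _ => rfl }
  -- Birkhoff's poset of sup-irreducibles, lifted from universe zero to `v`.
  refine ⟨ULift.{v} {a : {x // x ∈ D} // SupIrred a}, inferInstance, inferInstance, ?_, ⟨?_⟩⟩
  · rw [posetWidth_congr ULift.orderIso]
    exact posetWidth_supIrred_le_two f Subtype.val_injective
  · exact e.trans ((OrderIso.lowerSetSupIrred (α := {x // x ∈ D})).trans (LowerSet.map ULift.orderIso.symm))

theorem exists_diagram_of_lowerSet {P : Type u} [PartialOrder P] {Q : Type v} [PartialOrder Q]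
    [Finite Q] (hQ : posetWidth Q ≤ 2) (e : P ≃o LowerSet Q) :
    ∃ D : Finset (ℕ × ℕ), IsSimplyConnected D ∧ NoOutwardCorners D ∧ Defines D P := by
  obtain ⟨C, hC, hC'⟩ := exists_isChain_compl hQ
  obtain ⟨e'⟩ := defines_idealDiagram hC hC'
  exact ⟨idealDiagram hC hC', ⟨isConnected_idealDiagram hC hC', noHoles_idealDiagram hC hC'⟩,
    noOutwardCorners_idealDiagram hC hC', ⟨e.trans e'⟩⟩

end Diagram

end

theorem theorem4p2 (P : Type u) [PartialOrder P] [Finite P] :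
    -- posets defined by a simply connected diagram with no outward corners
    ((∃ D : Finset (ℕ × ℕ), Diagram.IsSimplyConnected D ∧ Diagram.NoOutwardCorners D ∧
          Diagram.Defines D P) →
        (Module.finrank ℝ (antichainToggleSpace P) : ℤ) = posetRank P + 1 ∧
        (Module.finrank ℝ (idealToggleSpace P) : ℤ) = posetRank P + 1) ∧
    -- lattices of order ideals of finite posets of width at most two
    ((∃ (Q : Type v) (_ : PartialOrder Q), Finite Q ∧ posetWidth Q ≤ 2 ∧
          Nonempty (P ≃o LowerSet Q)) →
        (Module.finrank ℝ (antichainToggleSpace P) : ℤ) = posetRank P + 1 ∧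
        (Module.finrank ℝ (idealToggleSpace P) : ℤ) = posetRank P + 1) ∧
    -- these are the same posets, apart from the empty one
    (Nonempty P →
      ((∃ D : Finset (ℕ × ℕ), Diagram.IsSimplyConnected D ∧ Diagram.NoOutwardCorners D ∧
          Diagram.Defines D P) ↔
        (∃ (Q : Type v) (_ : PartialOrder Q), Finite Q ∧ posetWidth Q ≤ 2 ∧
          Nonempty (P ≃o LowerSet Q)))) := by
  refine ⟨?_, ?_, fun _ => ⟨?_, ?_⟩⟩
  · rintro ⟨D, hconn, hD, h⟩
    exact Diagram.finrank_eq_of_defines hconn.1 hD h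
  · rintro ⟨Q, _, _, hQ, ⟨e⟩⟩
    obtain ⟨D, hconn, hD, h⟩ := Diagram.exists_diagram_of_lowerSet hQ e
    exact Diagram.finrank_eq_of_defines hconn.1 hD h
  · rintro ⟨D, hconn, hD, h⟩
    exact Diagram.exists_lowerSet_of_defines hconn.1 hD h
  · rintro ⟨Q, _, _, hQ, ⟨e⟩⟩
    exact Diagram.exists_diagram_of_lowerSet hQ e
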